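/- **Lowest-order $N$-point phase correlation.** For $b$ in an index set let $f^{(b)}$ be a real, zero-mean, statistically homogeneous random field with finite moments on a periodic $d$-dimensional box of volume $V=V_b$, with Fourier modes $f_{\boldsymbol k}=V^{-1/2}\int f(\boldsymbol x)e^{-i\boldsymbol k\cdot\boldsymbol x}\,d^dx$. Assume that the power spectrum $P(\boldsymbol k)=\langle|f_{\boldsymbol k}|^2\rangle$ and the polyspectra $P^{(n)}$ $(n\ge 3)$, given by $$\langle f_{\boldsymbol k_1}\cdots f_{\boldsymbol k_n}\rangle_{\rm c}=V^{1-n/2}\,\delta^{\rm K}_{\boldsymbol k_1+\cdots+\boldsymbol k_n}\,P^{(n)}(\boldsymbol k_1,\dots,\boldsymbol k_n),$$ do not depend on the box, and that $P^{(n)}(-\boldsymbol k_1,\dots,-\boldsymbol k_n)=P^{(n)}(\boldsymbol k_1,\dots,\boldsymbol k_n)$. Put $\alpha_{\boldsymbol k}=f_{\boldsymbol k}/\sqrt{P(\boldsymbol k)}=A_{\boldsymbol k}e^{i\theta_{\boldsymbol k}}$ and $$p^{(n)}(\boldsymbol k_1,\dots,\boldsymbol k_n)=\frac{\delta^{\rm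 K}_{\boldsymbol k_1+\cdots+\boldsymbol k_n}P^{(n)}(\boldsymbol k_1,\dots,\boldsymbol k_n)}{\sqrt{P(\boldsymbol k_1)\cdots P(\boldsymbol k_n)}}.$$ The joint density of finitely many modes is understood as the formal power series in $V^{-1/2}$ obtained by inverse Fourier transform, coefficient by coefficient, of the cumulant expansion $\langle e^{-iX}\rangle=\exp\sum_{n\ge2}\frac{(-i)^n}{n!}\langle X^n\rangle_{\rm c}$, where $X=\sum_{\boldsymbol k}(K_{\boldsymbol k}\,{\rm Re}\,\alpha_{\boldsymbol k}+L_{\boldsymbol k}\,{\rm Im}\,\alpha_{\boldsymbol k})$ and the $n$-th cumulant is counted as of order $V^{1-n/2}$. The phase densities $P_S$ of sets $S$ of modes are obtained from it by integrating over the moduli. The reduced functions $C_S$ $(|S|\ge2)$ are defined iteratively by $$(2\pi)^{|S|}P_S=\sum_{\pi}\ \prod_{B\in\pi,\ |B|\ge2}C_B ,$$ the sum running over the partitions $\pi$ of $S$; $C_N$ denotes $C_S$ for a set $S$ of $N$ modes. Let $N\ge2$, and let $\boldsymbol k_1,\dots,\boldsymbol k_N$ be distinct wavevectors of every box, lying in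 an upper half space (a set that contains exactly one of $\pm\boldsymbol k$ for each $\boldsymbol k\ne0$, and not $\boldsymbol 0$), with $P(\boldsymbol k_i)>0$. Suppose that $j_1,\dots,j_N$ are nonzero integers such that the integer relations $\sum_i c_i\boldsymbol k_i=\boldsymbol 0$ are exactly the integer multiples $c=tj$ of $j=(j_1,\dots,j_N)$ (one independent relation, with irreducible coefficients). Put $s_i=j_i/|j_i|$ and $J=\sum_i|j_i|$. Then $$C_N(\theta_1,\dots,\theta_N)=2V^{(2-J)/2}\,\prod_{i=1}^N\frac{\Gamma(1+|j_i|/2)}{|j_i|!}\,\cos\Big(\sum_i j_i\theta_i\Big)\,p^{(J)}\big(\underbrace{s_1\boldsymbol k_1,\dots,s_1\boldsymbol k_1}_{|j_1|},\dots,\underbrace{s_N\boldsymbol k_N,\dots,s_N\boldsymbol k_N}_{|j_N|}\big)+\mathcal O\big(V^{(1-J)/2}\big)$$ as a formal series in $V^{-1/2}$: the coefficients of $V^{-q/2}$ in $C_N$ with $q<J-2$ vanish, and that with $q=J-2$ is the displayed one. Moreover, for each $M\ge J-2$, the series truncated after the term $V^{-M/2}$ differs from the displayed leading term by at most $B\,V^{(1-J)/2}$,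 with $B$ independent of the phases and of the box, whenever $V\ge1$. -/

import Mathlib

open MeasureTheory

noncomputable section

/-- A real random field on the `d`-dimensional box with side lengths `side a` and periodic boundary
conditions (that is, on the torus `∏ₐ ℝ / side a ℤ`), with all moments finite, zero mean, and
statistically homogeneous: all finite-dimensional distributions are translation invariant. -/
structure BoxField (d : ℕ) where
  side : Fin d → ℝ
  side_pos : ∀ a, Fact (0 < side a)
  Ω : Type*
  [mΩ : MeasurableSpace Ω]
  μ : Measure Ω
  prob : IsProbabilityMeasure μ
  f : Ω → (∀ a, AddCircle (side a)) → ℝ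
  measurable_f : Measurable (Function.uncurry f)
  memLp_f : ∀ (n : ℕ) (x : ∀ a, AddCircle (side a)), MemLp (fun ω => f ω x) n μ
  mean_zero : ∀ x, ∫ ω, f ω x ∂μ = 0
  homogeneous : ∀ (n : ℕ) (x : Fin n → ∀ a, AddCircle (side a)) (y : ∀ a, AddCircle (side a)),
    μ.map (fun ω (r : Fin n) => f ω (x r + y)) = μ.map (fun ω (r : Fin n) => f ω (x r))

attribute [instance] BoxField.side_pos BoxField.mΩ BoxField.prob

/-- The joint cumulant `⟨Y₁ ⋯ Yₙ⟩_c` of complex random variables, as a sum over set partitions. -/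
def jointCumulant {Ω : Type*} [MeasurableSpace Ω] (μ : Measure Ω) {n : ℕ} (Y : Fin n → Ω → ℂ) :
    ℂ :=
  ∑ π : Finpartition (Finset.univ : Finset (Fin n)),
    (-1) ^ (π.parts.card - 1) * ((π.parts.card - 1).factorial : ℂ) *
      ∏ B ∈ π.parts, ∫ ω, ∏ r ∈ B, Y r ω ∂μ

namespace BoxField

variable {d : ℕ} (F : BoxField d)

/-- The volume `V = L₁ ⋯ L_d` of the box. -/
def vol : ℝ := ∏ a, F.side a

/-- The wavevector `(2π m₁ / L₁, …, 2π m_d / L_d)` of the Fourier mode with integer label `m`. -/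
def wave (m : Fin d → ℤ) : Fin d → ℝ := fun a => 2 * Real.pi * m a / F.side a

/-- The volume-normalized Fourier coefficient `f_k = V^{-1/2} ∫ f(x) e^{-i k·x} dx`,
`k = F.wave m`. (`fourier n x = e^{2π i n x / L}` on the circle of length `L`.) -/
def fourierMode (m : Fin d → ℤ) (ω : F.Ω) : ℂ :=
  ((Real.sqrt F.vol)⁻¹ : ℂ) * ∫ x, (F.f ω x : ℂ) * ∏ a, fourier (-(m a)) (x a)

/-- The power spectrum `P(k) = ⟨|f_k|²⟩`. -/
def power (m : Fin d → ℤ) : ℝ := ∫ ω, ‖F.fourierMode m ω‖ ^ 2 ∂F.μ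

/-- The normalized mode `α_k = f_k / √P(k)`. -/
def alpha (m : Fin d → ℤ) (ω : F.Ω) : ℂ :=
  F.fourierMode m ω / (Real.sqrt (F.power m) : ℂ)

/-- `F` has power spectrum `Pw` and polyspectra `P`, as functions of wavevectors:
`⟨|f_k|²⟩ = Pw(k)` and, for `n ≥ 3` and `k₁ + ⋯ + kₙ = 0`,
`⟨f_{k₁} ⋯ f_{kₙ}⟩_c = V^{1 - n/2} P(k₁, …, kₙ)`. -/
def HasPolyspectra (Pw : (Fin d → ℝ) → ℝ) (P : List (Fin d → ℝ) → ℂ) : Prop :=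
  (∀ m : Fin d → ℤ, F.power m = Pw (F.wave m)) ∧
  ∀ l : List (Fin d → ℤ), 3 ≤ l.length → l.sum = 0 →
    jointCumulant F.μ (fun r : Fin l.length => F.fourierMode (l.get r)) =
      ((F.vol ^ (1 - (l.length : ℝ) / 2) : ℝ) : ℂ) * P (l.map F.wave)

section Modes

variable {ι : Type*} (m : ι → Fin d → ℤ) (S : Finset ι)

/-- `X = ∑ (K_k a_k + L_k b_k)` over the modes in `S`, where `α_k = a_k + i b_k` and the
coefficients are collected in `ζ_k = K_k + i L_k`. -/
def linComb (ζ : S → ℂ) (ω : F.Ω) : ℂ :=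
  ((∑ i, ((ζ i).re * (F.alpha (m i) ω).re + (ζ i).im * (F.alpha (m i) ω).im) : ℝ) : ℂ)

/-- The rescaled cumulant `V^{n/2 - 1} ⟨Xⁿ⟩_c`. -/
def scaledCumulant (n : ℕ) (ζ : S → ℂ) : ℂ :=
  ((F.vol ^ ((n : ℝ) / 2 - 1) : ℝ) : ℂ) *
    jointCumulant F.μ (fun _ : Fin n => F.linComb m S ζ)

/-- The part `n ≥ 3` of the cumulant expansion `∑ₙ (-i)ⁿ / n! ⟨Xⁿ⟩_c` of `log ⟨e^{-iX}⟩`,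
as a formal power series in `V^{-1/2}`; the `n`-th cumulant has order `n - 2`. -/
def cumulantSeries (ζ : S → ℂ) : PowerSeries ℂ :=
  PowerSeries.mk fun q => if q = 0 then 0 else
    (-Complex.I) ^ (q + 2) / ((q + 2).factorial : ℂ) * F.scaledCumulant m S (q + 2) ζ

/-- The characteristic function `⟨e^{-iX}⟩ = exp (∑_{n ≥ 2} (-i)ⁿ / n! ⟨Xⁿ⟩_c)` of the modes
in `S`, as a formal power series in `V^{-1/2}` (the term `n = 1` vanishes by the zero mean). -/
def charSeries (ζ : S → ℂ) : PowerSeries ℂ :=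
  PowerSeries.C (Complex.exp (-(F.scaledCumulant m S 2 ζ) / 2)) *
    (PowerSeries.exp ℂ).subst (F.cumulantSeries m S ζ)

/-- The joint density of `(a_k, b_k)`, `k ∈ S`, at the point `α_k = a_k + i b_k`, as a formal power
series in `V^{-1/2}`: the inverse Fourier transform of the characteristic function. -/
def jointDensity (α : S → ℂ) : PowerSeries ℂ :=
  PowerSeries.mk fun q => ∫ ζ : S → ℂ,
    ((2 * Real.pi : ℂ) ^ (2 * S.card))⁻¹ *
      Complex.exp (Complex.I *
        ((∑ i, ((ζ i).re * (α i).re + (ζ i).im * (α i).im) : ℝ) : ℂ)) *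
      PowerSeries.coeff q (F.charSeries m S ζ)

/-- The joint density of the phases `θ_k`, `k ∈ S`, as a formal power series in `V^{-1/2}`:
the joint density in polar coordinates `α_k = A_k e^{iθ_k}`, integrated over the moduli. -/
def phaseDensity (θ : ι → ℝ) : PowerSeries ℂ :=
  PowerSeries.mk fun q => ∫ A : S → ℝ in Set.univ.pi fun _ => Set.Ioi 0,
    ((∏ i, A i : ℝ) : ℂ) *
      PowerSeries.coeff q
        (F.jointDensity m S fun i => (A i : ℂ) * Complex.exp (Complex.I * (θ i : ℂ)))

end Modes

end BoxField

open Classical in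
/-- The reduced functions `C_S` of a family `M_S` of functions of finite sets, defined iteratively
by `M_S = ∑_π ∏_{B ∈ π, |B| ≥ 2} C_B`, where `π` runs over all set partitions of `S`
(for example `M₂ = 1 + C₂`, `M₃ = 1 + C₂ + C₂ + C₂ + C₃`); used for `|S| ≥ 2`. -/
def reducedPart {ι R : Type*} [CommRing R] (M : Finset ι → R) (S : Finset ι) : R :=
  M S - ∑ π : {π : Finpartition S // S ∉ π.parts},
    ∏ B : {B : Finset ι // B ∈ π.1.parts.filter fun B => 2 ≤ B.card}, reducedPart M B.1
termination_by S.card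
decreasing_by
  have hB := (Finset.mem_filter.mp B.2).1
  refine Finset.card_lt_card (Finset.ssubset_iff_subset_ne.mpr ⟨π.1.le hB, fun h => π.2 ?_⟩)
  rwa [h] at hB

/-- The reduced phase distribution function `C_N(θ₁, …, θ_N)` of the modes `m₁, …, m_N`, as a formal
power series in `V^{-1/2}`, obtained from the phase densities `(2π)^|S| P_S`, `S ⊆ {1, …, N}`. -/
def BoxField.reducedPhase {d N : ℕ} (F : BoxField d) (m : Fin N → Fin d → ℤ) (θ : Fin N → ℝ) :
    PowerSeries ℂ :=
  reducedPart (fun S => PowerSeries.C ((2 * Real.pi : ℂ) ^ S.card) * F.phaseDensity m S θ)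
    Finset.univ

/-- An upper half `uhs` of the space of wavevectors: it contains exactly one of `k`, `-k` for each
`k ≠ 0`, and does not contain `0`. -/
structure IsUpperHalf {d : ℕ} (U : Set (Fin d → ℝ)) : Prop where
  zero_notMem : 0 ∉ U
  mem_or_neg_mem : ∀ k, k ≠ 0 → k ∈ U ∨ -k ∈ U
  neg_notMem : ∀ k, k ∈ U → -k ∉ U

/-- The normalized polyspectrum
`p(k₁, …, kₙ) = δ_{k₁ + ⋯ + kₙ} P(k₁, …, kₙ) / √(Pw(k₁) ⋯ Pw(kₙ))`. -/
def normPolyspectrum {d : ℕ} (Pw : (Fin d → ℝ) → ℝ) (P : List (Fin d → ℝ) → ℂ)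
    (l : List (Fin d → ℝ)) : ℂ :=
  open Classical in
  if l.sum = 0 then P l / (Real.sqrt (l.map Pw).prod : ℂ) else 0

/-- The list `s₁k₁, …, s₁k₁, …, s_Nk_N, …, s_Nk_N` in which `sᵢkᵢ` occurs `|jᵢ|` times, where `sᵢ`
is the sign of `jᵢ`. -/
def signedCopies {d N : ℕ} (j : Fin N → ℤ) (k : Fin N → Fin d → ℝ) : List (Fin d → ℝ) :=
  (List.finRange N).flatMap fun i => List.replicate (j i).natAbs ((j i).sign • k i)

end

/-! Collect the Fourier variables into `ζ_i = K_i + i L_i`. Since the field is real, `X` is a linear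
form in the modes with wavevectors `±k_i`; since it is homogeneous, a cumulant vanishes unless its
wavevectors add up to zero. Hence the second cumulant is `∑ |ζ_i|² / 2`, which produces the Gaussian
factor `e^{-∑ |ζ_i|² / 4}`, and each rescaled higher cumulant is a polynomial in `ζ, ζ̄` whose
coefficients are normalized polyspectra, with no trace of the box (`scaledCumulant_two`,
`scaledCumulant_eq`). Every coefficient of the phase density is therefore a linear functional,
`phaseFunctional`, of a polynomial.

This functional factorizes over the modes. A pure power `ζ^n` or `ζ̄^n` gives `(2i)^n Γ(1 + n/2)
e^{±inθ}`, while a polynomial in the products `ζ_i ζ̄_i` alone (a neutral one) is sent to its value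
at `ζ = 0`, whatever the phases (`phaseFunctional_neutral`).

A cumulant contains a non-neutral monomial only if the net occupation numbers of the modes form a
nontrivial integer relation `t j`. That takes all `N` modes and at least `J` factors. So proper
subsets of modes have uniform phases, which collapses the iterative definition to `C_N = (2π)^N P_N
- 1` (`reducedPart_eq_sub_one`), and all orders below `J - 2` vanish. At order `J - 2` the
exponential of the cumulants is neutral up to the term linear in the `J`-th cumulant
(`coeff_exp_subst_sub_mem`), where only `t = ±1` survive. Each sign comes from `J! / ∏ |j_i|!`
orderings with a common polyspectrum; the factors `(-i)^J / J!` and `i^J J!` cancel, and parity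
joins the two exponentials into the cosine (`phaseFunctional_cumulantPoly`). -/

noncomputable section

/-! ### Fourier and modulus integrals for a single mode -/

/-- The Gaussian plane wave `e^{i Re(ζ̄ α) - |ζ|² / 4}`. -/
def gaussWave (α ζ : ℂ) : ℂ :=
  Complex.exp (Complex.I * ((ζ.re * α.re + ζ.im * α.im : ℝ) : ℂ)) *
    Complex.exp (-((‖ζ‖ ^ 2 : ℝ) : ℂ) / 4)

lemma gaussWave_eq (α ζ : ℂ) : gaussWave α ζ =
    Complex.exp (Complex.I / 2 * (starRingEnd ℂ ζ * α + ζ * starRingEnd ℂ α) -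
      ζ * starRingEnd ℂ ζ / 4) := by
  rw [gaussWave, ← Complex.exp_add]
  congr 1
  rw [Complex.mul_conj, Complex.normSq_eq_norm_sq]
  have : ((ζ.re * α.re + ζ.im * α.im : ℝ) : ℂ) =
      (starRingEnd ℂ ζ * α + ζ * starRingEnd ℂ α) / 2 := by
    apply Complex.ext <;> simp; ring
  rw [this]; ring

lemma norm_gaussWave (α ζ : ℂ) : ‖gaussWave α ζ‖ = Real.exp (-(‖ζ‖ ^ 2) / 4) := by
  rw [gaussWave, norm_mul, mul_comm Complex.I, Complex.norm_exp_ofReal_mul_I, one_mul,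
    Complex.norm_exp]
  congr 1
  rw [← Complex.ofReal_neg]
  norm_cast

lemma continuous_gaussWave (α : ℂ) : Continuous (gaussWave α) := by
  unfold gaussWave; fun_prop

/-- Half of the Gaussian exponent absorbs the power, by `x^n / n! ≤ e^x` at `x = ‖ζ‖² / 8`; the
other half remains as an integrable majorant. -/
lemma integrable_pow_mul_exp_neg_sq (n : ℕ) :
    Integrable fun ζ : ℂ => ‖ζ‖ ^ n * Real.exp (-(‖ζ‖ ^ 2) / 4) := by
  have h0 : Integrable fun ζ : ℂ => Real.exp (-(‖ζ‖ ^ 2) / 8) := by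
    have := (GaussianFourier.integrable_cexp_neg_mul_sq_norm_add (V := ℂ) (b := 1 / 8)
      (by norm_num) 0 0).norm
    refine this.congr (Filter.Eventually.of_forall fun ζ => ?_)
    simp only [Complex.norm_exp]
    congr 1
    simp [← Complex.ofReal_pow]
    ring
  refine (h0.const_mul (1 + (n.factorial : ℝ) * 8 ^ n)).mono' (by fun_prop) ?_
  refine Filter.Eventually.of_forall fun ζ => ?_
  rw [Real.norm_of_nonneg (by positivity)]
  have hs : Real.exp (-(‖ζ‖ ^ 2) / 4) = Real.exp (-(‖ζ‖ ^ 2) / 8) * Real.exp (-(‖ζ‖ ^ 2) / 8) := by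
    rw [← Real.exp_add]; ring_nf
  rw [hs, ← mul_assoc]
  refine mul_le_mul_of_nonneg_right ?_ (Real.exp_pos _).le
  have h1 := Real.pow_div_factorial_le_exp (‖ζ‖ ^ 2 / 8) (by positivity) n
  have h2 : ‖ζ‖ ^ n ≤ 1 + (‖ζ‖ ^ 2) ^ n := by
    rcases le_total ‖ζ‖ 1 with h | h
    · have := pow_le_one₀ (n := n) (norm_nonneg ζ) h
      have : 0 ≤ (‖ζ‖ ^ 2) ^ n := by positivity
      linarith
    · rw [← pow_mul]
      have := pow_le_pow_right₀ h (show n ≤ 2 * n by omega)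
      linarith
  have h3 : (‖ζ‖ ^ 2) ^ n ≤ (n.factorial * 8 ^ n) * Real.exp (‖ζ‖ ^ 2 / 8) := by
    rw [div_pow, div_div, div_le_iff₀ (by positivity)] at h1
    linarith
  have h4 : Real.exp (-(‖ζ‖ ^ 2) / 8) ≤ 1 := Real.exp_le_one_iff.mpr (by
    have : 0 ≤ ‖ζ‖ ^ 2 := by positivity
    linarith)
  calc ‖ζ‖ ^ n * Real.exp (-(‖ζ‖ ^ 2) / 8)
      ≤ (1 + (n.factorial * 8 ^ n) * Real.exp (‖ζ‖ ^ 2 / 8)) * Real.exp (-(‖ζ‖ ^ 2) / 8) := by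
        gcongr; linarith
    _ = Real.exp (-(‖ζ‖ ^ 2) / 8) + (n.factorial * 8 ^ n) := by
        rw [add_mul, mul_assoc, ← Real.exp_add]
        ring_nf; simp
    _ ≤ _ := by linarith

lemma integrable_gaussWave_mul (α : ℂ) (a b : ℕ) :
    Integrable fun ζ : ℂ => gaussWave α ζ * (ζ ^ a * starRingEnd ℂ ζ ^ b) := by
  refine (integrable_pow_mul_exp_neg_sq (a + b)).mono' ?_ ?_
  · have := continuous_gaussWave α
    have h2 : Continuous fun ζ : ℂ => starRingEnd ℂ ζ := Complex.continuous_conj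
    exact (this.mul ((continuous_id.pow a).mul (h2.pow b))).aestronglyMeasurable
  · refine Filter.Eventually.of_forall fun ζ => ?_
    rw [norm_mul, norm_gaussWave, norm_mul, norm_pow, norm_pow, RCLike.norm_conj, pow_add, mul_comm]

/-- The Fourier transform of `ζ^a ζ̄^b e^{-|ζ|² / 4}` at `α`. -/
def modeTransform (a b : ℕ) (α : ℂ) : ℂ :=
  ∫ ζ : ℂ, gaussWave α ζ * (ζ ^ a * starRingEnd ℂ ζ ^ b)

lemma modeTransform_zero_zero (α : ℂ) :
    modeTransform 0 0 α = 4 * Real.pi * Complex.exp (-((‖α‖ ^ 2 : ℝ) : ℂ)) := by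
  have := GaussianFourier.integral_cexp_neg_mul_sq_norm_add (V := ℂ) (b := 1 / 4)
      (by norm_num) Complex.I α
  rw [Complex.finrank_real_complex] at this
  rw [modeTransform]
  convert! this using 1
  · congr 1; ext ζ
    rw [gaussWave, ← Complex.exp_add, pow_zero, pow_zero, mul_one, mul_one]
    congr 1
    rw [Complex.inner]
    push_cast
    simp
    ring
  · norm_num
    ring

lemma hasDerivAt_gaussWave_mul (α ζ v : ℂ) (a b : ℕ) :
    HasDerivAt (fun t : ℝ => gaussWave α (ζ + t • v) *
        ((ζ + t • v) ^ a * starRingEnd ℂ (ζ + t • v) ^ b))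
      (gaussWave α ζ * (ζ ^ a * starRingEnd ℂ ζ ^ b) *
          (Complex.I / 2 * (starRingEnd ℂ v * α + v * starRingEnd ℂ α) -
            (v * starRingEnd ℂ ζ + ζ * starRingEnd ℂ v) / 4) +
        gaussWave α ζ * ((a * ζ ^ (a - 1) * v) * starRingEnd ℂ ζ ^ b +
          ζ ^ a * (b * starRingEnd ℂ ζ ^ (b - 1) * starRingEnd ℂ v))) 0 := by
  have hz : HasDerivAt (fun t : ℝ => ζ + t • v) v 0 := by
    simpa using ((hasDerivAt_id (0 : ℝ)).smul_const v).const_add ζ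
  have hw : HasDerivAt (fun t : ℝ => starRingEnd ℂ (ζ + t • v)) (starRingEnd ℂ v) 0 := by
    have := ((hasDerivAt_id (0 : ℝ)).smul_const (starRingEnd ℂ v)).const_add (starRingEnd ℂ ζ)
    simpa using this
  have hE := ((((hw.mul_const α).add (hz.mul_const (starRingEnd ℂ α))).const_mul
    (Complex.I / 2)).sub ((hz.mul hw).div_const 4)).cexp
  have hE' : HasDerivAt (fun t : ℝ => gaussWave α (ζ + t • v))
      (gaussWave α ζ * (Complex.I / 2 * (starRingEnd ℂ v * α + v * starRingEnd ℂ α) -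
            (v * starRingEnd ℂ ζ + ζ * starRingEnd ℂ v) / 4)) 0 := by
    simp_rw [gaussWave_eq]
    convert! hE using 1
    simp
  have := hE'.mul ((hz.fun_pow a).mul (hw.fun_pow b))
  refine this.congr_deriv ?_
  simp
  ring

/-- Integration by parts against the constant `1`: the integral of a line derivative vanishes. The
truncated exponents `a - 1`, `b - 1` are harmless, since their terms carry the factors `a`, `b`. -/
lemma modeTransform_lineDeriv (α v : ℂ) (a b : ℕ) :
    Complex.I / 2 * (starRingEnd ℂ v * α + v * starRingEnd ℂ α) * modeTransform a b α +
      -v / 4 * modeTransform a (b + 1) α + -starRingEnd ℂ v / 4 * modeTransform (a + 1) b α +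
      a * v * modeTransform (a - 1) b α + b * starRingEnd ℂ v * modeTransform a (b - 1) α = 0 := by
  set G : ℕ → ℕ → ℂ → ℂ := fun p r ζ => gaussWave α ζ * (ζ ^ p * starRingEnd ℂ ζ ^ r) with hG
  have hi (p r : ℕ) (c : ℂ) : Integrable fun ζ => c * G p r ζ :=
    (integrable_gaussWave_mul α p r).const_mul c
  set D : ℂ → ℂ := fun ζ =>
    Complex.I / 2 * (starRingEnd ℂ v * α + v * starRingEnd ℂ α) * G a b ζ +
      -v / 4 * G a (b + 1) ζ + -starRingEnd ℂ v / 4 * G (a + 1) b ζ +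
      a * v * G (a - 1) b ζ + b * starRingEnd ℂ v * G a (b - 1) ζ with hD
  have hDi : Integrable D :=
    ((((hi _ _ _).add (hi _ _ _)).add (hi _ _ _)).add (hi _ _ _)).add (hi _ _ _)
  have hder (ζ : ℂ) : HasLineDerivAt ℝ (G a b) (D ζ) ζ v := by
    refine (hasDerivAt_gaussWave_mul α ζ v a b).congr_deriv ?_
    simp only [hD, hG]; ring
  have h0 : ∫ ζ, D ζ = 0 := by
    have := integral_bilinear_hasLineDerivAt_right_eq_neg_left_of_integrable (μ := volume)
      (f := fun _ : ℂ => (1 : ℝ)) (f' := fun _ => 0) (g := G a b) (g' := D) (v := v)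
      (B := ContinuousLinearMap.lsmul ℝ ℝ) (by simp) (by simpa using hDi)
      (by simpa using integrable_gaussWave_mul α a b)
      (fun x _ => by simpa [HasLineDerivAt] using hasDerivAt_const (0 : ℝ) (1 : ℝ))
      (fun x _ => hder x)
    simpa using this
  rw [← h0, hD]
  rw [integral_add ((((hi _ _ _).fun_add (hi _ _ _)).fun_add (hi _ _ _)).fun_add (hi _ _ _))
      (hi _ _ _),
    integral_add (((hi _ _ _).fun_add (hi _ _ _)).fun_add (hi _ _ _)) (hi _ _ _),
    integral_add ((hi _ _ _).fun_add (hi _ _ _)) (hi _ _ _), integral_add (hi _ _ _) (hi _ _ _)]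
  simp only [integral_const_mul]
  rfl

/-- Adding `i` times the derivative along `i` to the derivative along `1` gives twice the Wirtinger
derivative in `ζ̄`, which sees the Gaussian wave only through `iα/2 - ζ/4`; the term in `ζ/4` raises
`a`. -/
lemma modeTransform_succ_left (α : ℂ) (a b : ℕ) :
    modeTransform (a + 1) b α = 2 * Complex.I * α * modeTransform a b α +
      4 * b * modeTransform a (b - 1) α := by
  have h1 := modeTransform_lineDeriv α 1 a b
  have h2 := modeTransform_lineDeriv α Complex.I a b
  simp only [map_one, Complex.conj_I] at h1 h2
  linear_combination (-2) * h1 + (-2 * Complex.I) * h2 + (-Complex.I *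
    (α * modeTransform a b α - starRingEnd ℂ α * modeTransform a b α)
    - modeTransform a (b + 1) α / 2 + modeTransform (a + 1) b α / 2
    + 2 * a * modeTransform (a - 1) b α - 2 * b * modeTransform a (b - 1) α)
    * Complex.I_sq

lemma modeTransform_conj (α : ℂ) (a b : ℕ) :
    modeTransform a b (starRingEnd ℂ α) = modeTransform b a α := by
  unfold modeTransform
  have hmp : MeasurePreserving (starRingEnd ℂ : ℂ → ℂ) :=
    Complex.conjLIE.measurePreserving
  have hme : MeasurableEmbedding (starRingEnd ℂ : ℂ → ℂ) :=
    Complex.conjLIE.toHomeomorph.measurableEmbedding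
  rw [← hmp.integral_comp hme]
  congr 1; ext ζ
  simp only [gaussWave, Complex.conj_conj, Complex.conj_re, Complex.conj_im, RCLike.norm_conj]
  ring_nf

lemma modeTransform_zero_right (α : ℂ) (n : ℕ) :
    modeTransform n 0 α =
      (2 * Complex.I * α) ^ n * (4 * Real.pi * Complex.exp (-((‖α‖ ^ 2 : ℝ) : ℂ))) := by
  induction n with
  | zero => rw [modeTransform_zero_zero]; simp
  | succ n ih => rw [modeTransform_succ_left, ih, pow_succ]; simp; ring

lemma modeTransform_zero_left (α : ℂ) (n : ℕ) :
    modeTransform 0 n α =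
      (2 * Complex.I * starRingEnd ℂ α) ^ n *
        (4 * Real.pi * Complex.exp (-((‖α‖ ^ 2 : ℝ) : ℂ))) := by
  rw [← modeTransform_conj, modeTransform_zero_right, RCLike.norm_conj]

/-- A complex Hermite polynomial times the Gaussian. The recurrence in `a` is solved by induction:
Pascal's rule splits each binomial in `a + 1` into the two terms of the recurrence. -/
lemma modeTransform_eq (α : ℂ) (a b : ℕ) :
    modeTransform a b α =
      (∑ l ∈ Finset.range (a + 1), (a.choose l * b.choose l * l.factorial * 4 ^ l : ℂ) *
        (2 * Complex.I * α) ^ (a - l) * (2 * Complex.I * starRingEnd ℂ α) ^ (b - l)) *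
        (4 * Real.pi * Complex.exp (-((‖α‖ ^ 2 : ℝ) : ℂ))) := by
  induction a generalizing b with
  | zero => rw [modeTransform_zero_left]; simp
  | succ a ih =>
    rw [modeTransform_succ_left, ih, ih, ← mul_assoc, ← mul_assoc (4 * (b : ℂ)), ← add_mul]
    congr 1
    rw [Finset.sum_range_succ' _ (a + 1)]
    have h1 : ∀ l ∈ Finset.range (a + 1),
        ((a + 1).choose (l + 1) * b.choose (l + 1) * (l + 1).factorial * 4 ^ (l + 1) : ℂ) *
          (2 * Complex.I * α) ^ (a + 1 - (l + 1)) *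
          (2 * Complex.I * starRingEnd ℂ α) ^ (b - (l + 1)) =
        4 * b * ((a.choose l * (b - 1).choose l * l.factorial * 4 ^ l : ℂ) *
          (2 * Complex.I * α) ^ (a - l) * (2 * Complex.I * starRingEnd ℂ α) ^ (b - 1 - l)) +
        (a.choose (l + 1) * b.choose (l + 1) * (l + 1).factorial * 4 ^ (l + 1) : ℂ) *
          (2 * Complex.I * α) ^ (a - l) *
          (2 * Complex.I * starRingEnd ℂ α) ^ (b - (l + 1)) := by
      intro l hl
      -- Absorption identity for binomials, multiplied by `l!`.
      have hb : (b.choose (l + 1) * (l + 1).factorial : ℂ) =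
          b * ((b - 1).choose l * l.factorial) := by
        cases b with
        | zero => simp
        | succ b =>
          have := Nat.add_one_mul_choose_eq b l
          have h' : ((b : ℂ) + 1) * b.choose l = (b + 1).choose (l + 1) * (l + 1) := by
            exact_mod_cast this
          rw [Nat.factorial_succ]
          push_cast [Nat.add_sub_cancel]
          linear_combination -(l.factorial : ℂ) * h'
      rw [Nat.choose_succ_succ', show a + 1 - (l + 1) = a - l by omega,
        show b - 1 - l = b - (l + 1) by omega]
      push_cast
      linear_combination (a.choose l * 4 ^ (l + 1) *
          (2 * Complex.I * α) ^ (a - l) * (2 * Complex.I * starRingEnd ℂ α) ^ (b - (l + 1))) * hb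
    rw [Finset.sum_congr rfl h1, Finset.sum_add_distrib, ← Finset.mul_sum, add_comm, add_assoc]
    congr 1
    rw [Finset.sum_range_succ' _ a, Finset.sum_range_succ _ a, mul_add, Finset.mul_sum]
    simp only [Nat.choose_succ_self, Nat.cast_zero, zero_mul, add_zero]
    congr 1
    · refine Finset.sum_congr rfl fun l hl => ?_
      have : a - l = a - (l + 1) + 1 := by have := Finset.mem_range.mp hl; omega
      rw [this]; ring
    · simp; ring

/-- Rotating `α` by a unit `u` multiplies the term `l` by `u^(a-l) ū^(b-l)`, which equals `u^a ū^b`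
because `u ū = 1`. So the phase enters only through the charge `a - b`. -/
lemma modeTransform_polar (a b : ℕ) (u : ℂ) (hu : u * starRingEnd ℂ u = 1) (A : ℝ) :
    modeTransform a b (A * u) = u ^ a * starRingEnd ℂ u ^ b * modeTransform a b A := by
  have hn : ‖u‖ = 1 := by
    rw [Complex.mul_conj, Complex.normSq_eq_norm_sq] at hu
    have : ‖u‖ ^ 2 = 1 := by exact_mod_cast hu
    nlinarith [norm_nonneg u]
  rw [modeTransform_eq, modeTransform_eq, norm_mul, hn, mul_one, ← mul_assoc (_ * _) (∑ _ ∈ _, _),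
    Finset.mul_sum]
  congr 1
  refine Finset.sum_congr rfl fun l hl => ?_
  have hla : l ≤ a := by have := Finset.mem_range.mp hl; omega
  by_cases hlb : l ≤ b
  · have h1 : u ^ a = u ^ (a - l) * u ^ l := by rw [← pow_add]; congr 1; omega
    have h2 : starRingEnd ℂ u ^ b = starRingEnd ℂ u ^ (b - l) * starRingEnd ℂ u ^ l := by
      rw [← pow_add]; congr 1; omega
    have h3 : u ^ l * starRingEnd ℂ u ^ l = 1 := by rw [← mul_pow, hu, one_pow]
    rw [h1, h2, map_mul, Complex.conj_ofReal]
    simp only [mul_pow]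
    linear_combination (-(a.choose l * b.choose l * l.factorial * 4 ^ l : ℂ) *
        (2 ^ (a - l) * Complex.I ^ (a - l) * A ^ (a - l)) *
        (2 ^ (b - l) * Complex.I ^ (b - l) * A ^ (b - l)) * u ^ (a - l) *
        starRingEnd ℂ u ^ (b - l)) * h3
  -- For `l > b` the truncated exponent `b - l` is meaningless, but the binomial coefficient is
  -- zero.
  · rw [Nat.choose_eq_zero_of_lt (show b < l by omega)]; simp

lemma integral_pow_mul_exp_neg_sq_Ioi (n : ℕ) :
    ∫ A : ℝ in Set.Ioi 0, A ^ (n + 1) * Real.exp (-A ^ 2) = Real.Gamma (1 + n / 2) / 2 := by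
  have := integral_rpow_mul_exp_neg_rpow (p := 2) (q := (n + 1 : ℕ)) two_pos
    (by push_cast; linarith)
  rw [show (1 : ℝ) + n / 2 = (((n + 1 : ℕ) : ℝ) + 1) / 2 by push_cast; ring]
  simp only [Real.rpow_natCast, Real.rpow_two] at this
  rw [this]; ring

lemma integrableOn_pow_mul_exp_neg_sq_Ioi (n : ℕ) :
    IntegrableOn (fun A : ℝ => A ^ n * Real.exp (-A ^ 2)) (Set.Ioi 0) := by
  have := (integrable_rpow_mul_exp_neg_mul_sq (b := 1) one_pos (s := n)
    (by have : (0 : ℝ) ≤ n := n.cast_nonneg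
        linarith)).integrableOn (s := Set.Ioi 0)
  simpa using this

/-- Integral over the modulus of the Fourier transform of `ζ^a ζ̄^b e^{-|ζ|² / 4}`, normalized so
that the value is `1` for `a = b = 0`. -/
def phaseTransform (a b : ℕ) (θ : ℝ) : ℂ :=
  2 * Real.pi * ∫ A : ℝ in Set.Ioi 0, (A : ℂ) * (((2 * Real.pi : ℂ) ^ 2)⁻¹ *
    modeTransform a b (A * Complex.exp (Complex.I * θ)))

lemma modeTransform_ofReal (a b : ℕ) (A : ℝ) :
    (A : ℂ) * modeTransform a b A = ∑ l ∈ Finset.range (a + 1),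
      (4 * Real.pi * (a.choose l * b.choose l * l.factorial * 4 ^ l : ℂ) *
        (2 * Complex.I) ^ (a - l) * (2 * Complex.I) ^ (b - l)) *
        ((A ^ (a - l + (b - l) + 1) * Real.exp (-A ^ 2) : ℝ) : ℂ) := by
  rw [modeTransform_eq, Complex.conj_ofReal, Finset.sum_mul, Finset.mul_sum]
  refine Finset.sum_congr rfl fun l _ => ?_
  rw [Complex.norm_real, Real.norm_eq_abs, sq_abs]
  push_cast
  simp only [mul_pow, pow_add, pow_one]
  ring

lemma exp_I_mul_conj (θ : ℝ) : Complex.exp (Complex.I * θ) *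
    starRingEnd ℂ (Complex.exp (Complex.I * θ)) = 1 := by
  rw [← Complex.exp_conj, ← Complex.exp_add]; simp

lemma integrableOn_modeTransform (a b : ℕ) (θ : ℝ) :
    IntegrableOn (fun A : ℝ => (A : ℂ) * (((2 * Real.pi : ℂ) ^ 2)⁻¹ *
      modeTransform a b (A * Complex.exp (Complex.I * θ)))) (Set.Ioi 0) := by
  have h : IntegrableOn (fun A : ℝ => (A : ℂ) * modeTransform a b A) (Set.Ioi 0) := by
    simp_rw [modeTransform_ofReal]
    exact integrable_finsetSum _ fun l _ =>
      (integrableOn_pow_mul_exp_neg_sq_Ioi _).ofReal.const_mul _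
  refine (h.const_mul (((2 * Real.pi : ℂ) ^ 2)⁻¹ * (Complex.exp (Complex.I * θ) ^ a *
    starRingEnd ℂ (Complex.exp (Complex.I * θ)) ^ b))).congr
    (Filter.Eventually.of_forall fun A => ?_)
  simp only
  rw [modeTransform_polar a b _ (exp_I_mul_conj θ)]
  ring

/-- The modulus integrals are Gamma values over two, and the constants `2π · (2π)⁻² · 4π · 1/2`
multiply to one. -/
lemma phaseTransform_eq (a b : ℕ) (θ : ℝ) : phaseTransform a b θ =
    Complex.exp (Complex.I * θ) ^ a * starRingEnd ℂ (Complex.exp (Complex.I * θ)) ^ b *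
      ∑ l ∈ Finset.range (a + 1), (a.choose l * b.choose l * l.factorial * 4 ^ l : ℂ) *
        (2 * Complex.I) ^ (a - l) * (2 * Complex.I) ^ (b - l) *
        Real.Gamma (1 + (a - l + (b - l) : ℕ) / 2) := by
  unfold phaseTransform
  have h (A : ℝ) : (A : ℂ) * (((2 * Real.pi : ℂ) ^ 2)⁻¹ *
      modeTransform a b (A * Complex.exp (Complex.I * θ))) =
      (((2 * Real.pi : ℂ) ^ 2)⁻¹ * (Complex.exp (Complex.I * θ) ^ a *
        starRingEnd ℂ (Complex.exp (Complex.I * θ)) ^ b)) * ((A : ℂ) * modeTransform a b A) := by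
    rw [modeTransform_polar a b _ (exp_I_mul_conj θ)]; ring
  simp_rw [h, integral_const_mul, modeTransform_ofReal]
  rw [integral_finsetSum _ fun l _ =>
      (integrableOn_pow_mul_exp_neg_sq_Ioi _).ofReal.const_mul _]
  simp_rw [integral_const_mul, integral_complex_ofReal, integral_pow_mul_exp_neg_sq_Ioi]
  rw [Finset.mul_sum, Finset.mul_sum, Finset.mul_sum]
  refine Finset.sum_congr rfl fun l _ => ?_
  have : (Real.pi : ℂ) ≠ 0 := by exact_mod_cast Real.pi_ne_zero
  push_cast
  field_simp
  ring

lemma phaseTransform_zero_right (n : ℕ) (θ : ℝ) : phaseTransform n 0 θ =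
    (2 * Complex.I) ^ n * Real.Gamma (1 + n / 2) * Complex.exp (Complex.I * (n * θ)) := by
  rw [phaseTransform_eq, Finset.sum_range_succ']
  simp [← Complex.exp_nat_mul]
  ring_nf

lemma phaseTransform_zero_left (n : ℕ) (θ : ℝ) : phaseTransform 0 n θ =
    (2 * Complex.I) ^ n * Real.Gamma (1 + n / 2) * Complex.exp (-Complex.I * (n * θ)) := by
  rw [phaseTransform_eq]
  simp [← Complex.exp_nat_mul, ← Complex.exp_conj]
  ring_nf

/-- For equal exponents the Gamma value is `(n - l)!`, which turns the sum into a multiple of `∑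
(-1)^l C(n, l)`. Conceptually, a rotation-invariant characteristic function gives a uniform phase,
whose total mass is the value at the origin. -/
lemma phaseTransform_self (n : ℕ) (θ : ℝ) : phaseTransform n n θ = if n = 0 then 1 else 0 := by
  rw [phaseTransform_eq, ← mul_pow, exp_I_mul_conj, one_pow, one_mul]
  have h : ∀ l ∈ Finset.range (n + 1), (n.choose l * n.choose l * l.factorial * 4 ^ l : ℂ) *
      (2 * Complex.I) ^ (n - l) * (2 * Complex.I) ^ (n - l) *
        Real.Gamma (1 + (n - l + (n - l) : ℕ) / 2) =
      (4 ^ n * n.factorial * (-1) ^ n) * (((-1) ^ l * n.choose l : ℤ) : ℂ) := by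
    intro l hl
    have hl : l ≤ n := by have := Finset.mem_range.mp hl; omega
    have h1 : Real.Gamma (1 + (n - l + (n - l) : ℕ) / 2) = (n - l).factorial := by
      rw [← Real.Gamma_nat_eq_factorial]; push_cast; ring_nf
    have h2 : (n.choose l * l.factorial * (n - l).factorial : ℂ) = n.factorial := by
      exact_mod_cast Nat.choose_mul_factorial_mul_factorial hl
    have h3 : (2 * Complex.I) ^ (n - l) * (2 * Complex.I) ^ (n - l) = (-1) ^ (n - l) * 4 ^ (n - l) := by
      rw [← mul_pow, ← mul_pow]; congr 1; linear_combination 4 * Complex.I_sq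
    have h4 : (4 : ℂ) ^ n = 4 ^ l * 4 ^ (n - l) := by rw [← pow_add]; congr 1; omega
    have h5 : (-1 : ℂ) ^ n * (-1) ^ l = (-1) ^ (n - l) := by
      rw [← pow_add, show n + l = n - l + 2 * l by omega, pow_add, pow_mul]; simp
    rw [h1, h4, ← h2]
    push_cast
    linear_combination (n.choose l * n.choose l * l.factorial * 4 ^ l *
      (n - l).factorial : ℂ) * h3 - ((n.choose l * n.choose l * l.factorial * (n - l).factorial * 4 ^ l *
      4 ^ (n - l) : ℂ)) * h5
  rw [Finset.sum_congr rfl h, ← Finset.mul_sum, ← Int.cast_sum, Int.alternating_sum_range_choose]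
  split_ifs with hn
  · subst hn; simp
  · simp

/-- The source of the uniformity in the phases of the final error bound. -/
lemma norm_phaseTransform (a b : ℕ) (θ : ℝ) : ‖phaseTransform a b θ‖ = ‖phaseTransform a b 0‖ := by
  have h (φ : ℝ) : ‖Complex.exp (Complex.I * φ)‖ = 1 := by
    rw [mul_comm, Complex.norm_exp_ofReal_mul_I]
  simp only [phaseTransform_eq, norm_mul, norm_pow, RCLike.norm_conj, h]

/-! ### The phase functional on polynomials in several modes -/

section PhaseFunctional

variable {κ : Type*} [Fintype κ]

/-- The monomial `∏ ζ_i^{a_i} ζ̄_i^{b_i}`. -/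
def mono (a b : κ → ℕ) (ζ : κ → ℂ) : ℂ := ∏ i, (ζ i ^ a i * starRingEnd ℂ (ζ i) ^ b i)

lemma mono_mul_mono (a b a' b' : κ → ℕ) :
    mono a b * mono a' b' = mono (a + a') (b + b') := by
  ext ζ
  simp only [mono, Pi.mul_apply, ← Finset.prod_mul_distrib, Pi.add_apply, pow_add]
  exact Finset.prod_congr rfl fun i _ => by ring

lemma mono_zero : mono (0 : κ → ℕ) 0 = 1 := by ext ζ; simp [mono]

/-- The algebra of polynomials in `ζ_i` and `ζ̄_i`. -/
def polyAlg (κ : Type*) [Fintype κ] : Subalgebra ℂ ((κ → ℂ) → ℂ) :=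
  (Submodule.span ℂ (Set.range fun p : (κ → ℕ) × (κ → ℕ) => mono p.1 p.2)).toSubalgebra
    (Submodule.subset_span ⟨0, mono_zero⟩) fun φ ψ hφ hψ => by
      have h := Submodule.mul_mem_mul hφ hψ
      rw [Submodule.span_mul_span] at h
      refine Submodule.span_mono ?_ h
      rintro _ ⟨_, ⟨p, rfl⟩, _, ⟨p', rfl⟩, rfl⟩
      exact ⟨p + p', (mono_mul_mono _ _ _ _).symm⟩

/-- The algebra of polynomials in the products `ζ_i ζ̄_i`. -/
def neutralAlg (κ : Type*) [Fintype κ] : Subalgebra ℂ ((κ → ℂ) → ℂ) :=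
  (Submodule.span ℂ (Set.range fun a : κ → ℕ => mono a a)).toSubalgebra
    (Submodule.subset_span ⟨0, mono_zero⟩) fun φ ψ hφ hψ => by
      have h := Submodule.mul_mem_mul hφ hψ
      rw [Submodule.span_mul_span] at h
      refine Submodule.span_mono ?_ h
      rintro _ ⟨_, ⟨p, rfl⟩, _, ⟨p', rfl⟩, rfl⟩
      exact ⟨p + p', (mono_mul_mono _ _ _ _).symm⟩

lemma mono_mem_polyAlg (a b : κ → ℕ) : mono a b ∈ polyAlg κ :=
  Submodule.subset_span ⟨(a, b), rfl⟩

lemma mono_self_mem_neutralAlg (a : κ → ℕ) : mono a a ∈ neutralAlg κ :=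
  Submodule.subset_span ⟨a, rfl⟩

lemma neutralAlg_le_polyAlg : neutralAlg κ ≤ polyAlg κ :=
  Submodule.span_mono (by rintro _ ⟨a, rfl⟩; exact ⟨(a, a), rfl⟩)

/-- The density at `α` with characteristic function `e^{-∑ |ζ_i|² / 4} φ(ζ)`. -/
def densityTransform (φ : (κ → ℂ) → ℂ) (α : κ → ℂ) : ℂ :=
  ∫ ζ : κ → ℂ, ((2 * Real.pi : ℂ) ^ (2 * Fintype.card κ))⁻¹ *
    (∏ i, gaussWave (α i) (ζ i)) * φ ζ

/-- The density of the phases with characteristic function `e^{-∑ |ζ_i|² / 4} φ(ζ)`, relative to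
the uniform density. -/
def phaseFunctional (θ : κ → ℝ) (φ : (κ → ℂ) → ℂ) : ℂ :=
  (2 * Real.pi : ℂ) ^ Fintype.card κ *
    ∫ A : κ → ℝ in Set.univ.pi fun _ => Set.Ioi 0, ((∏ i, A i : ℝ) : ℂ) *
      densityTransform φ fun i => (A i : ℂ) * Complex.exp (Complex.I * (θ i : ℂ))

lemma densityIntegrand_mono (a b : κ → ℕ) (α ζ : κ → ℂ) :
    ((2 * Real.pi : ℂ) ^ (2 * Fintype.card κ))⁻¹ * (∏ i, gaussWave (α i) (ζ i)) * mono a b ζ =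
      ∏ i, ((2 * Real.pi : ℂ) ^ 2)⁻¹ *
        (gaussWave (α i) (ζ i) * (ζ i ^ a i * starRingEnd ℂ (ζ i) ^ b i)) := by
  simp only [Finset.prod_mul_distrib, mono, Finset.prod_const, Finset.card_univ]
  rw [inv_pow, ← pow_mul]
  ring

lemma integrable_density_mono (a b : κ → ℕ) (α : κ → ℂ) :
    Integrable fun ζ : κ → ℂ => ((2 * Real.pi : ℂ) ^ (2 * Fintype.card κ))⁻¹ *
      (∏ i, gaussWave (α i) (ζ i)) * mono a b ζ := by
  simp_rw [densityIntegrand_mono]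
  exact Integrable.fintype_prod_dep
    (f := fun i z => ((2 * Real.pi : ℂ) ^ 2)⁻¹ *
        (gaussWave (α i) z * (z ^ a i * starRingEnd ℂ z ^ b i)))
    fun i => (integrable_gaussWave_mul _ _ _).const_mul _

lemma densityTransform_mono (a b : κ → ℕ) (α : κ → ℂ) :
    densityTransform (mono a b) α =
      ∏ i, ((2 * Real.pi : ℂ) ^ 2)⁻¹ * modeTransform (a i) (b i) (α i) := by
  unfold densityTransform
  simp_rw [densityIntegrand_mono]
  rw [integral_fintype_prod_volume_eq_prod (f := fun i z => ((2 * Real.pi : ℂ) ^ 2)⁻¹ *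
        (gaussWave (α i) z * (z ^ a i * starRingEnd ℂ z ^ b i)))]
  simp_rw [integral_const_mul]
  rfl

lemma phaseIntegrand_mono (a b : κ → ℕ) (θ : κ → ℝ) (A : κ → ℝ) :
    ((∏ i, A i : ℝ) : ℂ) * densityTransform (mono a b)
      (fun i => (A i : ℂ) * Complex.exp (Complex.I * (θ i : ℂ))) =
    ∏ i, (A i : ℂ) * (((2 * Real.pi : ℂ) ^ 2)⁻¹ *
      modeTransform (a i) (b i) (A i * Complex.exp (Complex.I * (θ i : ℂ)))) := by
  simp only [densityTransform_mono, Complex.ofReal_prod, Finset.prod_mul_distrib]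

lemma restrict_positive_orthant :
    (volume : Measure (κ → ℝ)).restrict (Set.univ.pi fun _ => Set.Ioi 0) =
      Measure.pi fun _ => (volume : Measure ℝ).restrict (Set.Ioi 0) := by
  rw [volume_pi, Measure.restrict_pi_pi]

lemma integrableOn_phase_mono (a b : κ → ℕ) (θ : κ → ℝ) :
    IntegrableOn (fun A : κ → ℝ => ((∏ i, A i : ℝ) : ℂ) * densityTransform (mono a b)
      (fun i => (A i : ℂ) * Complex.exp (Complex.I * (θ i : ℂ))))
      (Set.univ.pi fun _ => Set.Ioi 0) := by
  simp_rw [phaseIntegrand_mono]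
  rw [IntegrableOn, restrict_positive_orthant]
  exact Integrable.fintype_prod_dep
    (f := fun i (A : ℝ) => (A : ℂ) * (((2 * Real.pi : ℂ) ^ 2)⁻¹ *
      modeTransform (a i) (b i) (A * Complex.exp (Complex.I * (θ i : ℂ)))))
    fun i => integrableOn_modeTransform _ _ _

lemma phaseFunctional_mono (a b : κ → ℕ) (θ : κ → ℝ) :
    phaseFunctional θ (mono a b) = ∏ i, phaseTransform (a i) (b i) (θ i) := by
  unfold phaseFunctional
  simp_rw [phaseIntegrand_mono]
  rw [restrict_positive_orthant, integral_fintype_prod_eq_prod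
    (f := fun i (A : ℝ) => (A : ℂ) * (((2 * Real.pi : ℂ) ^ 2)⁻¹ *
      modeTransform (a i) (b i) (A * Complex.exp (Complex.I * (θ i : ℂ)))))]
  simp only [phaseTransform, Finset.prod_mul_distrib, Finset.prod_const, Finset.card_univ, mul_pow]

/-- Integrals are additive only on integrable functions, so linearity of the functional is claimed
on `polyAlg` alone; this and `integrableOn_phase` justify it for the two successive integrations. -/
lemma integrable_density {φ : (κ → ℂ) → ℂ} (hφ : φ ∈ polyAlg κ) (α : κ → ℂ) :
    Integrable fun ζ : κ → ℂ => ((2 * Real.pi : ℂ) ^ (2 * Fintype.card κ))⁻¹ *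
      (∏ i, gaussWave (α i) (ζ i)) * φ ζ := by
  induction hφ using Submodule.span_induction with
  | mem φ h => obtain ⟨p, rfl⟩ := h; exact integrable_density_mono _ _ _
  | zero => simp
  | add φ ψ _ _ h h' =>
    refine (h.add h').congr (Filter.Eventually.of_forall fun ζ => ?_)
    simp only [Pi.add_apply]; ring
  | smul c φ _ h =>
    refine (h.const_mul c).congr (Filter.Eventually.of_forall fun ζ => ?_)
    simp only [Pi.smul_apply, smul_eq_mul]; ring

lemma densityTransform_add {φ ψ : (κ → ℂ) → ℂ} (hφ : φ ∈ polyAlg κ) (hψ : ψ ∈ polyAlg κ)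
    (α : κ → ℂ) : densityTransform (φ + ψ) α = densityTransform φ α + densityTransform ψ α := by
  unfold densityTransform
  rw [← integral_add (integrable_density hφ α) (integrable_density hψ α)]
  simp only [Pi.add_apply, mul_add]

lemma densityTransform_smul (c : ℂ) (φ : (κ → ℂ) → ℂ) (α : κ → ℂ) :
    densityTransform (c • φ) α = c * densityTransform φ α := by
  unfold densityTransform
  rw [← integral_const_mul]
  congr 1; ext ζ
  simp only [Pi.smul_apply, smul_eq_mul]; ring

lemma integrableOn_phase {φ : (κ → ℂ) → ℂ} (hφ : φ ∈ polyAlg κ) (θ : κ → ℝ) :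
    IntegrableOn (fun A : κ → ℝ => ((∏ i, A i : ℝ) : ℂ) * densityTransform φ
      (fun i => (A i : ℂ) * Complex.exp (Complex.I * (θ i : ℂ))))
      (Set.univ.pi fun _ => Set.Ioi 0) := by
  induction hφ using Submodule.span_induction with
  | mem φ h => obtain ⟨p, rfl⟩ := h; exact integrableOn_phase_mono _ _ _
  | zero => simp [densityTransform]
  | add φ ψ hφ hψ h h' =>
    refine (h.add h').congr (Filter.Eventually.of_forall fun A => ?_)
    simp only [Pi.add_apply, densityTransform_add hφ hψ]; ring
  | smul c φ _ h =>
    refine (h.const_mul c).congr (Filter.Eventually.of_forall fun A => ?_)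
    simp only [densityTransform_smul]; ring

lemma phaseFunctional_add {φ ψ : (κ → ℂ) → ℂ} (hφ : φ ∈ polyAlg κ) (hψ : ψ ∈ polyAlg κ)
    (θ : κ → ℝ) : phaseFunctional θ (φ + ψ) = phaseFunctional θ φ + phaseFunctional θ ψ := by
  unfold phaseFunctional
  rw [← mul_add, ← integral_add (integrableOn_phase hφ θ) (integrableOn_phase hψ θ)]
  simp only [densityTransform_add hφ hψ, mul_add]

lemma phaseFunctional_smul (c : ℂ) (φ : (κ → ℂ) → ℂ) (θ : κ → ℝ) :
    phaseFunctional θ (c • φ) = c * phaseFunctional θ φ := by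
  unfold phaseFunctional
  simp_rw [densityTransform_smul, mul_left_comm _ c]
  rw [integral_const_mul, mul_left_comm]

lemma phaseFunctional_zero (θ : κ → ℝ) : phaseFunctional θ (0 : (κ → ℂ) → ℂ) = 0 := by
  simpa using phaseFunctional_smul 0 (0 : (κ → ℂ) → ℂ) θ

lemma phaseFunctional_sum {τ : Type*} (s : Finset τ) (φ : τ → (κ → ℂ) → ℂ)
    (hφ : ∀ t ∈ s, φ t ∈ polyAlg κ) (θ : κ → ℝ) :
    phaseFunctional θ (∑ t ∈ s, φ t) = ∑ t ∈ s, phaseFunctional θ (φ t) := by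
  classical
  induction s using Finset.induction_on with
  | empty => simp [phaseFunctional_zero]
  | insert t s ht ih =>
    rw [Finset.sum_insert ht, Finset.sum_insert ht, phaseFunctional_add
      (hφ _ (Finset.mem_insert_self _ _))
      (Subalgebra.sum_mem _ fun u hu => hφ u (Finset.mem_insert_of_mem hu)),
      ih fun u hu => hφ u (Finset.mem_insert_of_mem hu)]

/-- The central cancellation. By linearity it is enough to treat a monomial `∏ (ζ_i ζ̄_i)^{a_i}`,
where `phaseTransform_self` gives zero unless every exponent is zero. Since neutral polynomials form
an algebra, products of cumulants need not be expanded. -/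
lemma phaseFunctional_neutral {φ : (κ → ℂ) → ℂ} (hφ : φ ∈ neutralAlg κ) (θ : κ → ℝ) :
    phaseFunctional θ φ = φ 0 := by
  induction hφ using Submodule.span_induction with
  | mem φ h =>
    obtain ⟨a, rfl⟩ := h
    simp only [phaseFunctional_mono, phaseTransform_self, mono, Pi.zero_apply, map_zero]
    refine Finset.prod_congr rfl fun i _ => ?_
    split_ifs with h <;> simp [h]
  | zero => simp [phaseFunctional_zero]
  | add φ ψ hφ hψ h h' =>
    rw [phaseFunctional_add (neutralAlg_le_polyAlg hφ) (neutralAlg_le_polyAlg hψ), h, h']; rfl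
  | smul c φ _ h => rw [phaseFunctional_smul, h]; rfl

lemma exists_norm_phaseFunctional_le {φ : (κ → ℂ) → ℂ} (hφ : φ ∈ polyAlg κ) :
    ∃ B, ∀ θ : κ → ℝ, ‖phaseFunctional θ φ‖ ≤ B := by
  induction hφ using Submodule.span_induction with
  | mem φ h =>
    obtain ⟨p, rfl⟩ := h
    refine ⟨∏ i, ‖phaseTransform (p.1 i) (p.2 i) 0‖, fun θ => ?_⟩
    simp only [phaseFunctional_mono, norm_prod, norm_phaseTransform _ _ (θ _), le_refl]
  | zero => exact ⟨0, fun θ => by simp [phaseFunctional_zero]⟩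
  | add φ ψ hφ hψ h h' =>
    obtain ⟨B, hB⟩ := h
    obtain ⟨B', hB'⟩ := h'
    refine ⟨B + B', fun θ => ?_⟩
    rw [phaseFunctional_add hφ hψ]
    exact (norm_add_le _ _).trans (add_le_add (hB θ) (hB' θ))
  | smul c φ _ h =>
    obtain ⟨B, hB⟩ := h
    refine ⟨‖c‖ * B, fun θ => ?_⟩
    rw [phaseFunctional_smul, norm_mul]
    exact mul_le_mul_of_nonneg_left (hB θ) (norm_nonneg c)

end PhaseFunctional

/-! ### Algebra of joint cumulants -/

section Cumulants

variable {Ω : Type*} [MeasurableSpace Ω] {μ : Measure Ω}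

/-- The extra monomial `l` makes the induction close: expanding one linear form moves one of its
variables into `l`. -/
lemma integrable_prod_linComb {E : Type*} [Fintype E] {Y : E → Ω → ℂ}
    (hY : ∀ l : Multiset E, Integrable (fun ω => (l.map fun e => Y e ω).prod) μ)
    {ι : Type*} (v : ι → E → ℂ) (B : Finset ι) (l : Multiset E) :
    Integrable (fun ω => (∏ r ∈ B, ∑ e, v r e * Y e ω) * (l.map fun e => Y e ω).prod) μ := by
  classical
  induction B using Finset.induction_on generalizing l with
  | empty => simpa using hY l
  | insert r B hr ih =>
    have : (fun ω => (∏ r ∈ insert r B, ∑ e, v r e * Y e ω) * (l.map fun e => Y e ω).prod) =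
        fun ω => ∑ e, v r e *
          ((∏ r ∈ B, ∑ e, v r e * Y e ω) * ((e ::ₘ l).map fun e => Y e ω).prod) := by
      ext ω
      rw [Finset.prod_insert hr, mul_assoc, Finset.sum_mul]
      refine Finset.sum_congr rfl fun e _ => ?_
      rw [Multiset.map_cons, Multiset.prod_cons]; ring
    rw [this]
    exact integrable_finsetSum _ fun e _ => (ih _).const_mul _

/-- In each partition exactly one block contains `r`, so the argument in position `r` enters through
a single expectation. This displays the linearity in that argument. -/
lemma jointCumulant_update {n : ℕ} {V : Type*} (Z : V → Ω → ℂ) (v : Fin n → V) (r : Fin n)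
    (x : V) : jointCumulant μ (fun r' => Z (Function.update v r x r')) =
    ∑ π : Finpartition (Finset.univ : Finset (Fin n)),
      ((-1) ^ (π.parts.card - 1) * ((π.parts.card - 1).factorial : ℂ) *
        ∏ B ∈ π.parts.erase (π.part r), ∫ ω, ∏ r' ∈ B, Z (v r') ω ∂μ) *
      ∫ ω, Z x ω * ∏ r' ∈ (π.part r).erase r, Z (v r') ω ∂μ := by
  refine Finset.sum_congr rfl fun π _ => ?_
  have hr : r ∈ π.part r := π.mem_part_self.mpr (Finset.mem_univ r)
  have h1 : ∀ B ∈ π.parts.erase (π.part r), ∫ ω, ∏ r' ∈ B, Z (Function.update v r x r') ω ∂μ =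
      ∫ ω, ∏ r' ∈ B, Z (v r') ω ∂μ := fun B hB => by
    refine integral_congr_ae (Filter.Eventually.of_forall fun ω => ?_)
    refine Finset.prod_congr rfl fun r' hr' => ?_
    rw [Function.update_of_ne]
    rintro rfl
    exact (Finset.mem_erase.mp hB).1 (π.part_eq_of_mem (Finset.mem_erase.mp hB).2 hr').symm
  have h2 : ∫ ω, ∏ r' ∈ π.part r, Z (Function.update v r x r') ω ∂μ =
      ∫ ω, Z x ω * ∏ r' ∈ (π.part r).erase r, Z (v r') ω ∂μ := by
    refine integral_congr_ae (Filter.Eventually.of_forall fun ω => ?_)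
    simp only
    rw [← Finset.mul_prod_erase _ _ hr, Function.update_self]
    congr 1
    refine Finset.prod_congr rfl fun r' hr' => ?_
    rw [Function.update_of_ne (Finset.ne_of_mem_erase hr')]
  rw [← Finset.mul_prod_erase _ _ (π.part_mem.mpr (Finset.mem_univ r)), h2,
    Finset.prod_congr rfl h1]
  ring

/-- The joint cumulant of linear combinations of given random variables, as a multilinear function
of the coefficients. -/
def cumulantMultilinear {E : Type*} [Fintype E] (Y : E → Ω → ℂ)
    (hY : ∀ l : Multiset E, Integrable (fun ω => (l.map fun e => Y e ω).prod) μ) (n : ℕ) :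
    MultilinearMap ℂ (fun _ : Fin n => E → ℂ) ℂ :=
  MultilinearMap.mk' (fun v => jointCumulant μ (fun r ω => ∑ e, v r e * Y e ω))
    (by
      intro v r x y
      have hi (x : E → ℂ) (π : Finpartition (Finset.univ : Finset (Fin n))) :
          Integrable (fun ω => (∑ e, x e * Y e ω) *
            ∏ r' ∈ (π.part r).erase r, ∑ e, v r' e * Y e ω) μ := by
        simp_rw [Finset.sum_mul]
        refine integrable_finsetSum _ fun e _ => ?_
        have := (integrable_prod_linComb hY v ((π.part r).erase r) {e}).const_mul (x e)
        refine this.congr (Filter.Eventually.of_forall fun ω => ?_)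
        simp; ring
      simp only [jointCumulant_update (fun (x : E → ℂ) ω => ∑ e, x e * Y e ω)]
      rw [← Finset.sum_add_distrib]
      refine Finset.sum_congr rfl fun π _ => ?_
      rw [← mul_add, ← integral_add (hi x π) (hi y π)]
      congr 1
      refine integral_congr_ae (Filter.Eventually.of_forall fun ω => ?_)
      simp only
      rw [← add_mul, ← Finset.sum_add_distrib]
      simp only [Pi.add_apply, add_mul])
    (by
      intro v r c x
      simp only [jointCumulant_update (fun (x : E → ℂ) ω => ∑ e, x e * Y e ω)]
      rw [smul_eq_mul, Finset.mul_sum]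
      refine Finset.sum_congr rfl fun π _ => ?_
      rw [mul_left_comm c]
      congr 1
      rw [← integral_const_mul]
      refine integral_congr_ae (Filter.Eventually.of_forall fun ω => ?_)
      simp only
      rw [← mul_assoc, Finset.mul_sum]
      simp only [Pi.smul_apply, smul_eq_mul, mul_assoc])

lemma jointCumulant_linComb {E : Type*} [Fintype E] {Y : E → Ω → ℂ}
    (hY : ∀ l : Multiset E, Integrable (fun ω => (l.map fun e => Y e ω).prod) μ) {n : ℕ}
    (w : Fin n → E → ℂ) :
    jointCumulant μ (fun r ω => ∑ e, w r e * Y e ω) =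
      ∑ s : Fin n → E, (∏ r, w r (s r)) * jointCumulant μ (fun r => Y (s r)) := by
  classical
  have h1 : jointCumulant μ (fun r ω => ∑ e, w r e * Y e ω) = cumulantMultilinear Y hY n w := rfl
  have h2 : w = fun r => ∑ e, w r e • (Pi.single e 1 : E → ℂ) := by
    ext r e
    simp [Finset.sum_apply, Pi.single_apply]
  rw [h1]
  conv_lhs => rw [h2]
  rw [MultilinearMap.map_sum]
  refine Finset.sum_congr rfl fun s _ => ?_
  rw [MultilinearMap.map_smul_univ (cumulantMultilinear Y hY n) (fun r => w r (s r))
    (fun r => Pi.single (s r) 1), smul_eq_mul]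
  congr 1
  change jointCumulant μ (fun r ω => ∑ e, (Pi.single (s r) 1 : E → ℂ) e * Y e ω) = _
  congr 1; ext r ω
  simp [Pi.single_apply]

/-- The image of a partition under a permutation. -/
def permFinpartition {n : ℕ} (σ : Equiv.Perm (Fin n))
    (π : Finpartition (Finset.univ : Finset (Fin n))) :
    Finpartition (Finset.univ : Finset (Fin n)) :=
  (π.map (⟨σ.finsetCongr, by simp⟩ : Finset (Fin n) ≃o Finset (Fin n))).copy (by
    change Finset.univ.map σ.toEmbedding = Finset.univ
    simp)

lemma permFinpartition_parts {n : ℕ} (σ : Equiv.Perm (Fin n))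
    (π : Finpartition (Finset.univ : Finset (Fin n))) :
    (permFinpartition σ π).parts = π.parts.map (Finset.mapEmbedding σ.toEmbedding).toEmbedding :=
  rfl

lemma jointCumulant_comp_perm {n : ℕ} (Y : Fin n → Ω → ℂ) (σ : Equiv.Perm (Fin n)) :
    jointCumulant μ (fun r => Y (σ r)) = jointCumulant μ Y := by
  have hinj : Function.Injective (permFinpartition σ) := by
    intro π π' h
    have h' := congrArg Finpartition.parts h
    rw [permFinpartition_parts, permFinpartition_parts] at h'
    exact Finpartition.ext (Finset.map_injective _ h')
  refine Fintype.sum_bijective _ (Finite.injective_iff_bijective.mp hinj) _ _ fun π => ?_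
  rw [permFinpartition_parts, Finset.card_map, Finset.prod_map]
  congr 1
  refine Finset.prod_congr rfl fun B _ => ?_
  congr 1; ext ω
  exact (Finset.prod_map B σ.toEmbedding fun r => Y r ω).symm

lemma sum_parts_sum {α G : Type*} [DecidableEq α] [AddCommMonoid G] {s : Finset α}
    (π : Finpartition s) (v : α → G) : ∑ B ∈ π.parts, ∑ r ∈ B, v r = ∑ r ∈ s, v r := by
  conv_rhs => rw [← π.biUnion_parts]
  rw [Finset.sum_biUnion π.disjoint]
  rfl

/-- If the total is nonzero, every partition has a block with nonzero sum, and the expectation over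
that block vanishes. -/
lemma jointCumulant_eq_zero_of_sum_ne_zero {G : Type*} [AddCommGroup G] {n : ℕ}
    (Y : Fin n → Ω → ℂ) (v : Fin n → G)
    (h : ∀ B : Finset (Fin n), ∑ r ∈ B, v r ≠ 0 → ∫ ω, ∏ r ∈ B, Y r ω ∂μ = 0)
    (hv : ∑ r, v r ≠ 0) : jointCumulant μ Y = 0 := by
  refine Finset.sum_eq_zero fun π _ => ?_
  obtain ⟨B, hB, hB0⟩ : ∃ B ∈ π.parts, ∑ r ∈ B, v r ≠ 0 := by
    by_contra! hc
    exact hv (by rw [← sum_parts_sum π, Finset.sum_eq_zero hc])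
  rw [Finset.prod_eq_zero hB (h B hB0), mul_zero]

lemma jointCumulant_two (Y : Fin 2 → Ω → ℂ) (h : ∀ r, ∫ ω, Y r ω ∂μ = 0) :
    jointCumulant μ Y = ∫ ω, Y 0 ω * Y 1 ω ∂μ := by
  have hne : (Finset.univ : Finset (Fin 2)) ≠ ⊥ := by decide
  rw [jointCumulant, Finset.sum_eq_single (Finpartition.indiscrete hne)]
  · simp [Finpartition.indiscrete]
  · intro π _ hπ
    by_cases h1 : ∃ r, {r} ∈ π.parts
    · obtain ⟨r, hr⟩ := h1
      rw [Finset.prod_eq_zero hr (by simpa using h r), mul_zero]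
    · push Not at h1
      refine absurd (Finpartition.ext ?_) hπ
      have hB : ∀ B ∈ π.parts, B = Finset.univ := by
        intro B hB
        rw [← Finset.card_eq_iff_eq_univ]
        have h2 := Finset.card_le_univ B
        have h3 := (π.nonempty_of_mem_parts hB).card_pos
        have h4 : B.card ≠ 1 := fun h => by
          obtain ⟨r, rfl⟩ := Finset.card_eq_one.mp h
          exact h1 r hB
        simp at h2 ⊢
        omega
      obtain ⟨B, hBm⟩ := π.parts_nonempty hne
      ext C
      simp only [Finpartition.indiscrete, Finset.mem_singleton]
      refine ⟨hB C, fun h => ?_⟩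
      have hC : C = B := h.trans (hB B hBm).symm
      rw [hC]
      exact hBm
  · simp

end Cumulants

/-! ### Fourier modes of a homogeneous field on the torus -/

lemma prod_le_one_add_sum_pow {n : ℕ} (a : Fin n → ℝ) (ha : ∀ r, 0 ≤ a r) :
    ∏ r, a r ≤ 1 + ∑ r, a r ^ n := by
  rcases Nat.eq_zero_or_pos n with rfl | hn
  · simp
  · have : Nonempty (Fin n) := ⟨⟨0, hn⟩⟩
    obtain ⟨r₀, -, h⟩ := Finset.exists_max_image Finset.univ a Finset.univ_nonempty
    have h1 : ∏ r, a r ≤ a r₀ ^ n := by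
      refine (Finset.prod_le_prod (fun r _ => ha r) fun r _ => h r (Finset.mem_univ r)).trans ?_
      simp
    have h2 := Finset.single_le_sum (f := fun r => a r ^ n) (fun r _ => pow_nonneg (ha r) n)
      (Finset.mem_univ r₀)
    linarith

namespace BoxField

variable {d : ℕ} (F : BoxField d)

/-- The plane wave `e^{-i k·x}`, `k = F.wave m`, on the torus. -/
def planeWave (m : Fin d → ℤ) (x : ∀ a, AddCircle (F.side a)) : ℂ := ∏ a, fourier (-(m a)) (x a)

lemma continuous_planeWave (m : Fin d → ℤ) : Continuous (F.planeWave m) := by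
  unfold planeWave; fun_prop

lemma norm_planeWave (m : Fin d → ℤ) (x) : ‖F.planeWave m x‖ = 1 := by
  rw [planeWave, norm_prod]
  exact Finset.prod_eq_one fun a _ => Circle.norm_coe _

lemma planeWave_neg (m : Fin d → ℤ) (x) :
    F.planeWave (-m) x = starRingEnd ℂ (F.planeWave m x) := by
  simp only [planeWave, map_prod, Pi.neg_apply]
  exact Finset.prod_congr rfl fun a _ => by rw [fourier_neg]

lemma planeWave_add_arg (m : Fin d → ℤ) (x y) :
    F.planeWave m (x + y) = F.planeWave m x * F.planeWave m y := by
  simp only [planeWave, ← Finset.prod_mul_distrib, Pi.add_apply]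
  refine Finset.prod_congr rfl fun a _ => ?_
  rw [fourier_apply, fourier_apply, fourier_apply, zsmul_add, AddCircle.toCircle_add]
  rfl

lemma planeWave_sum {ι : Type*} (s : Finset ι) (v : ι → Fin d → ℤ) (x) :
    F.planeWave (∑ r ∈ s, v r) x = ∏ r ∈ s, F.planeWave (v r) x := by
  classical
  induction s using Finset.induction_on with
  | empty => simp [planeWave]
  | insert r s hr ih =>
    rw [Finset.sum_insert hr, Finset.prod_insert hr, ← ih]
    simp only [planeWave, ← Finset.prod_mul_distrib, Pi.add_apply]
    refine Finset.prod_congr rfl fun a _ => ?_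
    rw [neg_add, fourier_add]

/-- Shift by half a period of the wave, along an axis on which its label is nonzero. -/
lemma exists_planeWave_eq_neg_one {m : Fin d → ℤ} (hm : m ≠ 0) : ∃ y, F.planeWave m y = -1 := by
  obtain ⟨a, ha⟩ := Function.ne_iff.mp hm
  have ha' : -(m a) ≠ 0 := neg_ne_zero.mpr ha
  refine ⟨Pi.single a ((F.side a / 2 / ((-(m a) : ℤ) : ℝ) : ℝ) : AddCircle (F.side a)), ?_⟩
  rw [planeWave, Finset.prod_eq_single a]
  · rw [Pi.single_eq_same]
    have := fourier_add_half_inv_index ha' (F.side_pos a).out (0 : AddCircle (F.side a))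
    rw [zero_add] at this
    rw [this, fourier_eval_zero]
  · intro b _ hb
    rw [Pi.single_eq_of_ne hb, fourier_eval_zero]
  · simp

lemma measurable_field (x) : Measurable fun ω => F.f ω x :=
  F.measurable_f.comp (measurable_id.prodMk measurable_const)

lemma integral_translate {n : ℕ} (g : (Fin n → ℝ) → ℂ) (hg : Measurable g) (x : Fin n → _) (y) :
    ∫ ω, g (fun r => F.f ω (x r + y)) ∂F.μ = ∫ ω, g (fun r => F.f ω (x r)) ∂F.μ := by
  have h1 := integral_map (μ := F.μ) (φ := fun ω (r : Fin n) => F.f ω (x r + y))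
    (measurable_pi_lambda _ fun r => F.measurable_field _).aemeasurable
    hg.aestronglyMeasurable
  have h2 := integral_map (μ := F.μ) (φ := fun ω (r : Fin n) => F.f ω (x r))
    (measurable_pi_lambda _ fun r => F.measurable_field _).aemeasurable
    hg.aestronglyMeasurable
  rw [← h1, ← h2, F.homogeneous]

lemma integral_abs_pow_eq (n : ℕ) (x) :
    ∫ ω, |F.f ω x| ^ n ∂F.μ = ∫ ω, |F.f ω 0| ^ n ∂F.μ := by
  have := F.integral_translate (n := 1) (fun g => ((|g 0| ^ n : ℝ) : ℂ))
    (by fun_prop) (fun _ => 0) x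
  simp only [zero_add, integral_complex_ofReal] at this
  exact_mod_cast this

lemma integrable_abs_pow (n : ℕ) (x) : Integrable (fun ω => |F.f ω x| ^ n) F.μ := by
  simpa using (F.memLp_f n x).integrable_norm_pow'

/-- The product is at most `1 + ∑ |f(x_r)|^n`; by homogeneity the `n`-th absolute moment is the same
at every point, so the majorant is integrable over the finite-volume torus. This permits Fubini for
products of modes. -/
lemma integrable_prod_field {n : ℕ} (v : Fin n → Fin d → ℤ) :
    Integrable (fun p : F.Ω × (Fin n → ∀ a, AddCircle (F.side a)) =>
      ∏ r, ((F.f p.1 (p.2 r) : ℂ) * F.planeWave (v r) (p.2 r))) (F.μ.prod volume) := by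
  have hm (r : Fin n) : Measurable fun p : F.Ω × (Fin n → ∀ a, AddCircle (F.side a)) =>
      F.f p.1 (p.2 r) :=
    F.measurable_f.comp (measurable_fst.prodMk ((measurable_pi_apply r).comp measurable_snd))
  have hw (r : Fin n) : Measurable fun p : F.Ω × (Fin n → ∀ a, AddCircle (F.side a)) =>
      F.planeWave (v r) (p.2 r) :=
    (F.continuous_planeWave _).measurable.comp ((measurable_pi_apply r).comp measurable_snd)
  have hi (r : Fin n) : Integrable (fun p : F.Ω × (Fin n → ∀ a, AddCircle (F.side a)) =>
      |F.f p.1 (p.2 r)| ^ n) (F.μ.prod volume) := by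
    have hmr : AEStronglyMeasurable (fun p : F.Ω × (Fin n → ∀ a, AddCircle (F.side a)) =>
        |F.f p.1 (p.2 r)| ^ n) (F.μ.prod volume) :=
      ((continuous_abs.measurable.comp (hm r)).pow_const n).aestronglyMeasurable
    rw [integrable_prod_iff' hmr]
    refine ⟨Filter.Eventually.of_forall fun x => F.integrable_abs_pow n (x r), ?_⟩
    simp only [norm_pow, Real.norm_eq_abs, abs_abs, F.integral_abs_pow_eq n]
    exact integrable_const _
  refine ((integrable_const (1 : ℝ)).add (integrable_finsetSum Finset.univ fun r _ => hi r)).mono'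
    ?_ (Filter.Eventually.of_forall fun p => ?_)
  · exact (Finset.measurable_prod _ fun r _ =>
      (Complex.measurable_ofReal.comp (hm r)).mul (hw r)).aestronglyMeasurable
  · simp only [norm_prod, norm_mul, norm_planeWave, mul_one, Complex.norm_real, Real.norm_eq_abs]
    exact prod_le_one_add_sum_pow _ fun r => abs_nonneg _

lemma prod_fourierMode {n : ℕ} (v : Fin n → Fin d → ℤ) (ω : F.Ω) :
    ∏ r, F.fourierMode (v r) ω = ((Real.sqrt F.vol)⁻¹ : ℂ) ^ n *
      ∫ x : Fin n → ∀ a, AddCircle (F.side a),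
        ∏ r, ((F.f ω (x r) : ℂ) * F.planeWave (v r) (x r)) := by
  rw [integral_fintype_prod_volume_eq_prod
    (f := fun r x => ((F.f ω x : ℂ) * F.planeWave (v r) x))]
  simp only [fourierMode, Finset.prod_mul_distrib, Finset.prod_const, Finset.card_univ,
    Fintype.card_fin]
  rfl

lemma integrable_prod_fourierMode {n : ℕ} (v : Fin n → Fin d → ℤ) :
    Integrable (fun ω => ∏ r, F.fourierMode (v r) ω) F.μ := by
  simp_rw [prod_fourierMode]
  exact (F.integrable_prod_field v).integral_prod_left.const_mul _

/-- Translating all points by a `y` at which the plane wave of the total wavevector equals `-1`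
changes the sign of the integrand, by homogeneity, and preserves the integral, by invariance of the
measure. -/
lemma integral_prod_fourierMode_eq_zero {n : ℕ} (v : Fin n → Fin d → ℤ) (hv : ∑ r, v r ≠ 0) :
    ∫ ω, ∏ r, F.fourierMode (v r) ω ∂F.μ = 0 := by
  simp_rw [prod_fourierMode]
  rw [integral_const_mul]
  suffices h : ∫ ω, (∫ x : Fin n → ∀ a, AddCircle (F.side a),
      ∏ r, ((F.f ω (x r) : ℂ) * F.planeWave (v r) (x r))) ∂F.μ = 0 by rw [h, mul_zero]
  rw [integral_integral_swap (F.integrable_prod_field v)]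
  set Φ : (Fin n → ∀ a, AddCircle (F.side a)) → ℂ := fun x =>
    ∫ ω, ∏ r, ((F.f ω (x r) : ℂ) * F.planeWave (v r) (x r)) ∂F.μ with hΦ
  obtain ⟨y, hy⟩ := F.exists_planeWave_eq_neg_one hv
  have hneg (x) : Φ (x + fun _ => y) = -Φ x := by
    have h1 := F.integral_translate (n := n) (fun g => ∏ r, (g r : ℂ)) (by fun_prop) x y
    have h2 : ∏ r, F.planeWave (v r) y = -1 := by rw [← planeWave_sum, hy]
    simp only [hΦ, Finset.prod_mul_distrib, integral_mul_const, Pi.add_apply, planeWave_add_arg,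
      h1, h2]
    ring
  have h3 := integral_add_left_eq_self (μ := volume) Φ (fun _ => y)
  simp_rw [add_comm (fun _ => y), hneg, integral_neg] at h3
  exact self_eq_neg.mp h3.symm

lemma integrable_multiset_prod_fourierMode (l : Multiset (Fin d → ℤ)) :
    Integrable (fun ω => (l.map fun m => F.fourierMode m ω).prod) F.μ := by
  induction l using Quotient.inductionOn with
  | h l =>
    have := F.integrable_prod_fourierMode fun r : Fin l.length => l.get r
    refine this.congr (Filter.Eventually.of_forall fun ω => ?_)
    simp only [Multiset.quot_mk_to_coe, Multiset.map_coe, Multiset.prod_coe]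
    rw [← List.prod_ofFn]
    congr 1
    exact List.ofFn_getElem_eq_map l fun m => F.fourierMode m ω

lemma integral_finset_prod_fourierMode_eq_zero {ι : Type*} (B : Finset ι) (v : ι → Fin d → ℤ)
    (hv : ∑ r ∈ B, v r ≠ 0) : ∫ ω, ∏ r ∈ B, F.fourierMode (v r) ω ∂F.μ = 0 := by
  have := F.integral_prod_fourierMode_eq_zero (fun r => v (B.equivFin.symm r)) (by
    rwa [Equiv.sum_comp B.equivFin.symm (fun r => v r), Finset.sum_coe_sort])
  rw [← this]
  congr 1; ext ω
  rw [Equiv.prod_comp B.equivFin.symm (fun r => F.fourierMode (v r) ω),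
    Finset.prod_coe_sort B fun r => F.fourierMode (v r) ω]

lemma jointCumulant_fourierMode_eq_zero {n : ℕ} (v : Fin n → Fin d → ℤ) (hv : ∑ r, v r ≠ 0) :
    jointCumulant F.μ (fun r => F.fourierMode (v r)) = 0 :=
  jointCumulant_eq_zero_of_sum_ne_zero _ v
    (fun B hB => F.integral_finset_prod_fourierMode_eq_zero B v hB) hv

lemma fourierMode_neg (m : Fin d → ℤ) (ω : F.Ω) :
    F.fourierMode (-m) ω = starRingEnd ℂ (F.fourierMode m ω) := by
  rw [fourierMode, fourierMode, map_mul, ← integral_conj, map_inv₀, Complex.conj_ofReal]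
  congr 2; ext x
  rw [map_mul, Complex.conj_ofReal]
  exact congrArg _ (F.planeWave_neg m x)

lemma integral_fourierMode_mul_neg (m : Fin d → ℤ) :
    ∫ ω, F.fourierMode m ω * F.fourierMode (-m) ω ∂F.μ = F.power m := by
  simp_rw [fourierMode_neg, Complex.mul_conj, Complex.normSq_eq_norm_sq]
  rw [integral_complex_ofReal]
  rfl

lemma power_neg (m : Fin d → ℤ) : F.power (-m) = F.power m := by
  simp only [power, fourierMode_neg, RCLike.norm_conj]

lemma wave_injective : Function.Injective F.wave := by
  intro m m' h
  ext a
  have h1 := congrFun h a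
  have h2 := (F.side_pos a).out.ne'
  have h3 := Real.pi_ne_zero
  simp only [wave] at h1
  field_simp at h1
  exact_mod_cast h1

/-- `F.wave` as a homomorphism. -/
def waveHom : (Fin d → ℤ) →+ (Fin d → ℝ) where
  toFun := F.wave
  map_zero' := by ext a; simp [wave]
  map_add' m m' := by ext a; simp [wave]; ring

lemma vol_pos : 0 < F.vol := Finset.prod_pos fun a _ => (F.side_pos a).out

end BoxField

/-! ### Cumulants of the linear form as polynomials over signed modes -/

section SignedModes

variable {κ : Type*}

/-- The wavevectors `k i` and `-k i`. -/
def signedWave {G : Type*} [Neg G] (k : κ → G) (e : κ × Bool) : G := if e.2 then k e.1 else -k e.1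

/-- Coefficients of the signed modes in `∑ (K_i a_i + L_i b_i)`. -/
def signedCoeff (ζ : κ → ℂ) (e : κ × Bool) : ℂ :=
  (if e.2 then starRingEnd ℂ (ζ e.1) else ζ e.1) / 2

/-- The `n`-th rescaled cumulant, as a polynomial in `ζ` and `ζ̄`. -/
def cumulantPoly {d : ℕ} [Fintype κ] (k : κ → Fin d → ℝ) (Pw : (Fin d → ℝ) → ℝ)
    (P : List (Fin d → ℝ) → ℂ) (n : ℕ) (ζ : κ → ℂ) : ℂ :=
  ∑ s : Fin n → κ × Bool, (∏ r, signedCoeff ζ (s r)) *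
    normPolyspectrum Pw P (List.ofFn fun r => signedWave k (s r))

lemma signedWave_map {G H : Type*} [AddGroup G] [AddGroup H] (f : G →+ H) (k : κ → G)
    (e : κ × Bool) : f (signedWave k e) = signedWave (fun i => f (k i)) e := by
  unfold signedWave; split_ifs <;> simp

end SignedModes

namespace BoxField

variable {d : ℕ} (F : BoxField d)

lemma jointCumulant_of_hasPolyspectra {Pw : (Fin d → ℝ) → ℝ} {P : List (Fin d → ℝ) → ℂ}
    (hP : F.HasPolyspectra Pw P) {n : ℕ} (hn : 3 ≤ n) (v : Fin n → Fin d → ℤ)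
    (hv : ∑ r, v r = 0) : jointCumulant F.μ (fun r => F.fourierMode (v r)) =
      ((F.vol ^ (1 - (n : ℝ) / 2) : ℝ) : ℂ) * P (List.ofFn fun r => F.wave (v r)) := by
  have key (l : List (Fin d → ℤ)) (hl : l.length = n) (hs : l.sum = 0) :
      jointCumulant F.μ (fun r : Fin n => F.fourierMode (l.get (r.cast hl.symm))) =
      ((F.vol ^ (1 - (n : ℝ) / 2) : ℝ) : ℂ) * P (l.map F.wave) := by
    subst hl
    exact hP.2 l hn hs
  have := key (List.ofFn v) List.length_ofFn (by rw [List.sum_ofFn, hv])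
  rw [List.map_ofFn] at this
  simpa [Function.comp_def] using this

lemma power_signedWave {ι : Type*} (m : ι → Fin d → ℤ) (e : ι × Bool) :
    F.power (signedWave m e) = F.power (m e.1) := by
  unfold signedWave; split_ifs <;> simp [power_neg]

section Modes

variable {ι : Type*} (m : ι → Fin d → ℤ) (S : Finset ι)

/-- Here `K a + L b = Re(ζ̄ α) = (ζ̄ α + ζ ᾱ) / 2`, and `ᾱ` belongs to the wavevector `-k` because
the field is real. -/
lemma linComb_eq (ζ : S → ℂ) (ω : F.Ω) : F.linComb m S ζ ω =
    ∑ e : S × Bool, (signedCoeff ζ e / (Real.sqrt (F.power (m e.1)) : ℂ)) *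
      F.fourierMode (signedWave (fun i : S => m i) e) ω := by
  rw [linComb, Fintype.sum_prod_type, Complex.ofReal_sum]
  refine Finset.sum_congr rfl fun i _ => ?_
  rw [Fintype.sum_bool]
  simp only [signedCoeff, signedWave, if_true, Bool.false_eq_true, if_false, fourierMode_neg]
  set α := F.fourierMode (m i) ω / (Real.sqrt (F.power (m i)) : ℂ) with hα
  have h1 : F.alpha (m i) ω = α := rfl
  have h2 : starRingEnd ℂ α =
      starRingEnd ℂ (F.fourierMode (m i) ω) / (Real.sqrt (F.power (m i)) : ℂ) := by
    rw [hα, map_div₀, Complex.conj_ofReal]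
  have h3 : (((ζ i).re * α.re + (ζ i).im * α.im : ℝ) : ℂ) =
      (starRingEnd ℂ (ζ i) * α + ζ i * starRingEnd ℂ α) / 2 := by
    apply Complex.ext <;> simp; ring
  rw [h1, h3, h2, hα]
  ring

lemma integrable_signedModes (l : Multiset (S × Bool)) :
    Integrable (fun ω => (l.map fun e =>
      F.fourierMode (signedWave (fun i : S => m i) e) ω).prod) F.μ := by
  have := F.integrable_multiset_prod_fourierMode (l.map (signedWave fun i : S => m i))
  simpa [Multiset.map_map, Function.comp_def] using this

lemma jointCumulant_linComb_eq (n : ℕ) (ζ : S → ℂ) :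
    jointCumulant F.μ (fun _ : Fin n => F.linComb m S ζ) =
      ∑ s : Fin n → S × Bool,
        (∏ r, signedCoeff ζ (s r) / (Real.sqrt (F.power (m (s r).1)) : ℂ)) *
        jointCumulant F.μ (fun r => F.fourierMode (signedWave (fun i : S => m i) (s r))) := by
  have h : F.linComb m S ζ = fun ω => ∑ e : S × Bool,
      (signedCoeff ζ e / (Real.sqrt (F.power (m e.1)) : ℂ)) *
      F.fourierMode (signedWave (fun i : S => m i) e) ω := funext (F.linComb_eq m S ζ)
  rw [h]
  exact jointCumulant_linComb (F.integrable_signedModes m S) fun _ e =>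
    signedCoeff ζ e / (Real.sqrt (F.power (m e.1)) : ℂ)

/-- The factor `V^{n/2-1}` cancels the `V^{1-n/2}` of the polyspectrum, and sequences with nonzero
total vanish on both sides. The right side depends on the box only through the wavevectors. -/
lemma scaledCumulant_eq {Pw : (Fin d → ℝ) → ℝ} {P : List (Fin d → ℝ) → ℂ}
    (hP : F.HasPolyspectra Pw P) {n : ℕ} (hn : 3 ≤ n) (ζ : S → ℂ) :
    F.scaledCumulant m S n ζ = cumulantPoly (fun i : S => F.wave (m i)) Pw P n ζ := by
  rw [scaledCumulant, jointCumulant_linComb_eq, cumulantPoly, Finset.mul_sum]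
  refine Finset.sum_congr rfl fun s _ => ?_
  have hw : ∀ r, signedWave (fun i : S => F.wave (m i)) (s r) =
      F.wave (signedWave (fun i : S => m i) (s r)) := fun r =>
    (signedWave_map F.waveHom (fun i : S => m i) (s r)).symm
  have hsum : (List.ofFn fun r => signedWave (fun i : S => F.wave (m i)) (s r)).sum =
      F.wave (∑ r, signedWave (fun i : S => m i) (s r)) := by
    rw [List.sum_ofFn]
    simp_rw [hw]
    exact (map_sum F.waveHom _ _).symm
  have h0 : F.wave 0 = 0 := F.waveHom.map_zero
  by_cases hs : ∑ r, signedWave (fun i : S => m i) (s r) = 0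
  · rw [normPolyspectrum, if_pos (by rw [hsum, hs, h0]), F.jointCumulant_of_hasPolyspectra hP hn _ hs,
      Finset.prod_div_distrib, List.map_ofFn, List.prod_ofFn]
    simp only [hw, Function.comp_apply]
    rw [Real.sqrt_prod _ fun r _ => by
      rw [← hP.1]; exact integral_nonneg fun ω => by positivity]
    have hv : ((F.vol ^ ((n : ℝ) / 2 - 1) : ℝ) : ℂ) * ((F.vol ^ (1 - (n : ℝ) / 2) : ℝ) : ℂ) = 1 := by
      rw [← Complex.ofReal_mul, ← Real.rpow_add F.vol_pos]
      simp
    rw [Complex.ofReal_prod]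
    simp_rw [← hP.1, power_signedWave]
    linear_combination ((∏ r, signedCoeff ζ (s r)) /
      (∏ r, (Real.sqrt (F.power (m (s r).1)) : ℂ)) *
      P (List.ofFn fun r => F.wave (signedWave (fun i : S => m i) (s r)))) * hv
  · rw [F.jointCumulant_fourierMode_eq_zero _ hs, normPolyspectrum, if_neg]
    · simp
    · rw [hsum, ← h0]
      exact fun h => hs (F.wave_injective h)

/-- Only the pairs `(k, -k)` and `(-k, k)` have zero total, and each contributes `|ζ_i|² / 4` after
normalization by the power. -/
lemma scaledCumulant_two (hm : Function.Injective m) (hm' : ∀ i i', m i + m i' ≠ 0)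
    (hpow : ∀ i, 0 < F.power (m i)) (ζ : S → ℂ) :
    F.scaledCumulant m S 2 ζ = ((∑ i, ‖ζ i‖ ^ 2 : ℝ) : ℂ) / 2 := by
  classical
  have hne (e : S × Bool) : signedWave (fun i : S => m i) e ≠ 0 := by
    have : m e.1 ≠ 0 := fun h => hm' e.1 e.1 (by rw [h, add_zero])
    unfold signedWave; split_ifs <;> simpa
  -- Two signed modes cancel only if they are opposite copies of one mode: other coincidences would
  -- make two labels equal or opposite.
  have hflip (e e' : S × Bool) (h : e' ≠ (e.1, !e.2)) :
      signedWave (fun i : S => m i) e + signedWave (fun i : S => m i) e' ≠ 0 := by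
    obtain ⟨i, x⟩ := e
    obtain ⟨i', x'⟩ := e'
    intro h0
    have hi : i' ≠ i ∨ x' = x := by
      by_contra! hc
      refine h (Prod.ext hc.1 ?_)
      cases x <;> cases x' <;> simp_all
    have hii : i' ≠ i → m i' ≠ m i := fun hh he => hh (Subtype.ext (hm he))
    have h1 := hm' i i'
    cases x <;> cases x' <;>
      simp only [signedWave, if_true, Bool.false_eq_true, if_false] at h0 hi
    · exact h1 (by rw [← neg_add, neg_eq_zero] at h0; exact h0)
    · exact hii (by simpa using hi) (by rw [neg_add_eq_zero] at h0; exact h0.symm)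
    · exact hii (by simpa using hi) (by rw [add_neg_eq_zero] at h0; exact h0.symm)
    · exact h1 h0
  have hzero (s : Fin 2 → S × Bool) (r : Fin 2) :
      ∫ ω, F.fourierMode (signedWave (fun i : S => m i) (s r)) ω ∂F.μ = 0 := by
    simpa using F.integral_prod_fourierMode_eq_zero (n := 1)
      (fun _ => signedWave (fun i : S => m i) (s r)) (by simpa using hne _)
  rw [scaledCumulant, jointCumulant_linComb_eq]
  simp only [Nat.cast_ofNat, div_self (two_ne_zero (α := ℝ)), sub_self, Real.rpow_zero,
    Complex.ofReal_one, one_mul]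
  rw [← (finTwoArrowEquiv (S × Bool)).symm.sum_comp, Fintype.sum_prod_type]
  have hterm (e e' : S × Bool) : (∏ r, signedCoeff ζ ((finTwoArrowEquiv (S × Bool)).symm (e, e') r) /
        (Real.sqrt (F.power (m ((finTwoArrowEquiv (S × Bool)).symm (e, e') r).1)) : ℂ)) *
      jointCumulant F.μ (fun r => F.fourierMode (signedWave (fun i : S => m i)
        ((finTwoArrowEquiv (S × Bool)).symm (e, e') r))) =
      if e' = (e.1, !e.2) then ((‖ζ e.1‖ ^ 2 : ℝ) : ℂ) / 4 else 0 := by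
    rw [jointCumulant_two _ (hzero _)]
    simp only [Fin.prod_univ_two, finTwoArrowEquiv_symm_apply, Matrix.cons_val_zero,
      Matrix.cons_val_one]
    split_ifs with h
    · have h1 : signedWave (fun i : S => m i) e' = -signedWave (fun i : S => m i) e := by
        obtain ⟨i, x⟩ := e
        subst h
        cases x <;> simp [signedWave]
      have h2 : signedCoeff ζ e * signedCoeff ζ e' = ((‖ζ e.1‖ ^ 2 : ℝ) : ℂ) / 4 := by
        obtain ⟨i, x⟩ := e
        subst h
        rw [← Complex.normSq_eq_norm_sq, ← Complex.mul_conj]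
        cases x <;> simp [signedCoeff] <;> ring
      have h3 : (Real.sqrt (F.power (m e.1)) : ℂ) * (Real.sqrt (F.power (m e.1)) : ℂ) =
          F.power (m e.1) := by
        rw [← Complex.ofReal_mul, Real.mul_self_sqrt (hpow _).le]
      have h4 : e'.1 = e.1 := by rw [h]
      have h5 : (F.power (m e.1) : ℂ) ≠ 0 := by exact_mod_cast (hpow _).ne'
      rw [h1, integral_fourierMode_mul_neg, power_signedWave, h4, div_mul_div_comm, h2, h3,
        div_mul_cancel₀ _ h5]
    · have := F.integral_prod_fourierMode_eq_zero
        ![signedWave (fun i : S => m i) e, signedWave (fun i : S => m i) e']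
        (by simpa using hflip e e' h)
      simp only [Fin.prod_univ_two, Matrix.cons_val_zero, Matrix.cons_val_one] at this
      rw [this, mul_zero]
  simp_rw [hterm]
  simp only [Finset.sum_ite_eq', Finset.mem_univ, if_true]
  rw [Fintype.sum_prod_type]
  simp only [Fintype.sum_bool]
  rw [Complex.ofReal_sum, Finset.sum_div]
  exact Finset.sum_congr rfl fun i _ => by ring

end Modes

end BoxField

/-! ### Coefficients of the exponential of a power series -/

section ExpSubst

lemma coeff_pow_eq_zero_of_lt {G : PowerSeries ℂ} (hG : PowerSeries.constantCoeff G = 0)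
    {q r : ℕ} (h : q < r) : PowerSeries.coeff q (G ^ r) = 0 :=
  PowerSeries.X_pow_dvd_iff.mp (pow_dvd_pow_of_dvd (PowerSeries.X_dvd_iff.mpr hG) r) q h

lemma coeff_exp_subst {G : PowerSeries ℂ} (hG : PowerSeries.constantCoeff G = 0) (q : ℕ) :
    PowerSeries.coeff q ((PowerSeries.exp ℂ).subst G) =
      ∑ r ∈ Finset.range (q + 1), (r.factorial : ℂ)⁻¹ * PowerSeries.coeff q (G ^ r) := by
  rw [PowerSeries.coeff_subst' (PowerSeries.HasSubst.of_constantCoeff_zero' hG),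
    finsum_eq_sum_of_support_subset (s := Finset.range (q + 1))]
  · refine Finset.sum_congr rfl fun r _ => ?_
    simp [PowerSeries.coeff_exp]
  · intro r hr
    by_contra hc
    refine hr ?_
    simp only [Finset.coe_range, Set.mem_Iio, not_lt] at hc
    simp only [coeff_pow_eq_zero_of_lt hG (show q < r by omega), smul_zero]

variable {X : Type*} (B : Subalgebra ℂ (X → ℂ)) {G : X → PowerSeries ℂ}

lemma coeff_pow_mem {q : ℕ} (hG : ∀ l ≤ q, (fun x => PowerSeries.coeff l (G x)) ∈ B) (r : ℕ) :
    ∀ l ≤ q, (fun x => PowerSeries.coeff l (G x ^ r)) ∈ B := by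
  induction r with
  | zero =>
    intro l _
    simp only [pow_zero, PowerSeries.coeff_one]
    split_ifs
    · exact one_mem B
    · exact zero_mem B
  | succ r ih =>
    intro l hl
    have : (fun x => PowerSeries.coeff l (G x ^ (r + 1))) =
        ∑ p ∈ Finset.HasAntidiagonal.antidiagonal l, (fun x => PowerSeries.coeff p.1 (G x ^ r)) *
          fun x => PowerSeries.coeff p.2 (G x) := by
      ext x
      simp [pow_succ, PowerSeries.coeff_mul]
    rw [this]
    refine sum_mem fun p hp => ?_
    have hpl := Finset.HasAntidiagonal.mem_antidiagonal.mp hp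
    exact mul_mem (ih _ (by omega)) (hG _ (by omega))

lemma coeff_exp_subst_mem (hG0 : ∀ x, PowerSeries.constantCoeff (G x) = 0) {q : ℕ}
    (hG : ∀ l ≤ q, (fun x => PowerSeries.coeff l (G x)) ∈ B) :
    (fun x => PowerSeries.coeff q ((PowerSeries.exp ℂ).subst (G x))) ∈ B := by
  have : (fun x => PowerSeries.coeff q ((PowerSeries.exp ℂ).subst (G x))) =
      ∑ r ∈ Finset.range (q + 1), (r.factorial : ℂ)⁻¹ •
        fun x => PowerSeries.coeff q (G x ^ r) := by
    ext x
    simp [coeff_exp_subst (hG0 x)]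
  rw [this]
  exact sum_mem fun r _ => B.smul_mem (coeff_pow_mem B hG r q le_rfl) _

/-- With zero constant term, the top coefficient `q` of `G` can enter a product of two or more
factors only next to a zero coefficient, so the lower coefficients suffice. -/
lemma coeff_pow_mem_of_lt (hG0 : ∀ x, PowerSeries.constantCoeff (G x) = 0) {q : ℕ}
    (hG : ∀ l < q, (fun x => PowerSeries.coeff l (G x)) ∈ B) (r : ℕ) :
    (fun x => PowerSeries.coeff q (G x ^ (r + 2))) ∈ B := by
  have hlt (l : ℕ) (hl : l < q) (r : ℕ) : (fun x => PowerSeries.coeff l (G x ^ r)) ∈ B :=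
    coeff_pow_mem B (q := l) (fun l' hl' => hG l' (by omega)) r l le_rfl
  have : (fun x => PowerSeries.coeff q (G x ^ (r + 2))) =
      ∑ p ∈ Finset.HasAntidiagonal.antidiagonal q, (fun x => PowerSeries.coeff p.1 (G x ^ (r + 1))) *
        fun x => PowerSeries.coeff p.2 (G x) := by
    ext x
    simp [pow_succ _ (r + 1), PowerSeries.coeff_mul]
  rw [this]
  refine sum_mem fun p hp => ?_
  have hpq := Finset.HasAntidiagonal.mem_antidiagonal.mp hp
  rcases Nat.eq_zero_or_pos p.1 with h1 | h1
  · have : (fun x => PowerSeries.coeff p.1 (G x ^ (r + 1))) = 0 := by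
      ext x
      exact coeff_pow_eq_zero_of_lt (hG0 x) (by omega)
    rw [this, zero_mul]
    exact zero_mem B
  rcases Nat.eq_zero_or_pos p.2 with h2 | h2
  · have : (fun x => PowerSeries.coeff p.2 (G x)) = 0 := by
      ext x
      rw [h2, PowerSeries.coeff_zero_eq_constantCoeff_apply, hG0 x]; rfl
    rw [this, mul_zero]
    exact zero_mem B
  · exact mul_mem (hlt _ (by omega) _) (hG _ (by omega))

/-- Isolates the linear term of the exponential: with `B` the neutral algebra and `q = J - 2`, only
the `J`-th cumulant can then depend on the phases. -/
lemma coeff_exp_subst_sub_mem (hG0 : ∀ x, PowerSeries.constantCoeff (G x) = 0) {q : ℕ}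
    (hq : 1 ≤ q) (hG : ∀ l < q, (fun x => PowerSeries.coeff l (G x)) ∈ B) :
    (fun x => PowerSeries.coeff q ((PowerSeries.exp ℂ).subst (G x))) -
      (fun x => PowerSeries.coeff q (G x)) ∈ B := by
  have : (fun x => PowerSeries.coeff q ((PowerSeries.exp ℂ).subst (G x))) -
      (fun x => PowerSeries.coeff q (G x)) =
      ∑ r ∈ Finset.range (q - 1), ((r + 2).factorial : ℂ)⁻¹ •
        fun x => PowerSeries.coeff q (G x ^ (r + 2)) := by
    ext x
    simp only [Pi.sub_apply, coeff_exp_subst (hG0 x), Finset.sum_apply, Pi.smul_apply, smul_eq_mul]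
    rw [show q + 1 = q - 1 + 1 + 1 by omega, Finset.sum_range_succ', Finset.sum_range_succ',
      pow_zero, PowerSeries.coeff_one, if_neg (by omega)]
    simp
  rw [this]
  exact sum_mem fun r _ => B.smul_mem (coeff_pow_mem_of_lt B hG0 hG r) _

lemma exp_subst_zero : (PowerSeries.exp ℂ).subst (0 : PowerSeries ℂ) = (1 : PowerSeries ℂ) := by
  ext q
  rw [coeff_exp_subst (map_zero _), Finset.sum_range_succ']
  simp

end ExpSubst

/-! ### Reduced functions when all proper subsets are trivial -/

/-- By induction `C_B = 0` for every proper `B` with at least two elements. Hence only the partition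
into singletons contributes, with an empty product. -/
lemma reducedPart_eq_sub_one {ι R : Type*} [CommRing R] (M : Finset ι → R) (S : Finset ι)
    (hS : 2 ≤ S.card) (hM : ∀ T, T ⊂ S → M T = 1) : reducedPart M S = M S - 1 := by
  classical
  induction S using Finset.strongInduction with
  | H S ih =>
    have hzero (T : Finset ι) (hT : T ⊂ S) (hc : 2 ≤ T.card) : reducedPart M T = 0 := by
      rw [ih T hT hc fun T' hT' => hM T' (hT'.trans hT), hM T hT, sub_self]
    have hsub (π : Finpartition S) (hπ : S ∉ π.parts) (B : Finset ι) (hB : B ∈ π.parts) :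
        B ⊂ S :=
      Finset.ssubset_iff_subset_ne.mpr ⟨π.le hB, fun h => hπ (h ▸ hB)⟩
    have hbot : S ∉ (⊥ : Finpartition S).parts := by
      rw [Finpartition.mem_bot_iff]
      rintro ⟨a, -, rfl⟩
      simp at hS
    rw [reducedPart]
    congr 1
    rw [Fintype.sum_eq_single ⟨⊥, hbot⟩]
    · refine Finset.prod_eq_one fun B _ => absurd B.2 ?_
      rw [Finset.mem_filter, Finpartition.mem_bot_iff]
      rintro ⟨⟨a, -, h⟩, h2⟩
      rw [← h] at h2
      simp at h2
    · intro π hπ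
      obtain ⟨B, hB, hB2⟩ : ∃ B ∈ π.1.parts, 2 ≤ B.card := by
        by_contra! hc
        refine hπ (Subtype.ext (le_bot_iff.mp fun B hB => ?_))
        have h1 := (π.1.nonempty_of_mem_parts hB).card_pos
        have h2 := hc B hB
        obtain ⟨a, rfl⟩ := Finset.card_eq_one.mp (show B.card = 1 by omega)
        exact ⟨{a}, Finpartition.mem_bot_iff.mpr
          ⟨a, π.1.le hB (Finset.mem_singleton_self a), rfl⟩, le_rfl⟩
      exact Finset.prod_eq_zero (Finset.mem_univ ⟨B, Finset.mem_filter.mpr ⟨hB, hB2⟩⟩)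
        (hzero B (hsub _ π.2 B hB) hB2)

/-! ### The characteristic function as a box-independent series of polynomials -/

section PolySeries

variable {d : ℕ} {κ : Type*} [Fintype κ] (k : κ → Fin d → ℝ) (Pw : (Fin d → ℝ) → ℝ)
  (P : List (Fin d → ℝ) → ℂ)

/-- The part `n ≥ 3` of the cumulant expansion, with polynomial coefficients. -/
def polySeries (ζ : κ → ℂ) : PowerSeries ℂ :=
  PowerSeries.mk fun q => if q = 0 then 0 else
    (-Complex.I) ^ (q + 2) / ((q + 2).factorial : ℂ) * cumulantPoly k Pw P (q + 2) ζ

/-- The coefficient of order `q` of the characteristic function, divided by its Gaussian part. -/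
def charPoly (q : ℕ) (ζ : κ → ℂ) : ℂ :=
  PowerSeries.coeff q ((PowerSeries.exp ℂ).subst (polySeries k Pw P ζ))

lemma constantCoeff_polySeries (ζ : κ → ℂ) :
    PowerSeries.constantCoeff (polySeries k Pw P ζ) = 0 := by
  rw [← PowerSeries.coeff_zero_eq_constantCoeff_apply, polySeries, PowerSeries.coeff_mk, if_pos rfl]

lemma coeff_polySeries {q : ℕ} (hq : 1 ≤ q) :
    (fun ζ => PowerSeries.coeff q (polySeries k Pw P ζ)) =
      ((-Complex.I) ^ (q + 2) / ((q + 2).factorial : ℂ)) • cumulantPoly k Pw P (q + 2) := by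
  ext ζ
  rw [polySeries, PowerSeries.coeff_mk, if_neg (by omega)]
  rfl

lemma coeff_polySeries_mem (B : Subalgebra ℂ ((κ → ℂ) → ℂ)) {q : ℕ}
    (h : 1 ≤ q → cumulantPoly k Pw P (q + 2) ∈ B) :
    (fun ζ => PowerSeries.coeff q (polySeries k Pw P ζ)) ∈ B := by
  rcases Nat.eq_zero_or_pos q with rfl | hq
  · simp only [PowerSeries.coeff_zero_eq_constantCoeff_apply, constantCoeff_polySeries]
    exact zero_mem B
  · rw [coeff_polySeries k Pw P hq]
    exact B.smul_mem (h hq) _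

lemma cumulantPoly_zero {n : ℕ} (hn : n ≠ 0) : cumulantPoly k Pw P n 0 = 0 := by
  refine Finset.sum_eq_zero fun s _ => ?_
  have : ∏ r, signedCoeff (0 : κ → ℂ) (s r) = 0 :=
    Finset.prod_eq_zero (Finset.mem_univ (⟨0, by omega⟩ : Fin n)) (by simp [signedCoeff])
  rw [this, zero_mul]

lemma charPoly_zero (q : ℕ) : charPoly k Pw P q 0 = if q = 0 then 1 else 0 := by
  have : polySeries k Pw P 0 = 0 := by
    ext q
    rw [polySeries, PowerSeries.coeff_mk, cumulantPoly_zero k Pw P (by omega)]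
    simp
  rw [charPoly, this, exp_subst_zero, PowerSeries.coeff_one]

end PolySeries

namespace BoxField

variable {d : ℕ} (F : BoxField d) {ι : Type*} (m : ι → Fin d → ℤ) (S : Finset ι)

lemma coeff_charSeries {Pw : (Fin d → ℝ) → ℝ} {P : List (Fin d → ℝ) → ℂ}
    (hP : F.HasPolyspectra Pw P) (hm : Function.Injective m) (hm' : ∀ i i', m i + m i' ≠ 0)
    (hpow : ∀ i, 0 < F.power (m i)) (q : ℕ) (ζ : S → ℂ) :
    PowerSeries.coeff q (F.charSeries m S ζ) =
      (∏ i, Complex.exp (-((‖ζ i‖ ^ 2 : ℝ) : ℂ) / 4)) *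
        charPoly (fun i : S => F.wave (m i)) Pw P q ζ := by
  have h : F.cumulantSeries m S ζ = polySeries (fun i : S => F.wave (m i)) Pw P ζ := by
    ext q
    rw [cumulantSeries, polySeries, PowerSeries.coeff_mk, PowerSeries.coeff_mk]
    split_ifs with hq
    · rfl
    · rw [F.scaledCumulant_eq m S hP (by omega)]
  rw [charSeries, PowerSeries.coeff_C_mul, h, F.scaledCumulant_two m S hm hm' hpow,
    ← Complex.exp_sum, charPoly]
  congr 2
  rw [Complex.ofReal_sum, ← Finset.sum_div, Finset.sum_neg_distrib]
  ring

/-- Bridge from the probabilistic definition to algebra: the second cumulant supplies the Gaussian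
inside `gaussWave`, and the remainder is a polynomial. -/
lemma coeff_phaseDensity {Pw : (Fin d → ℝ) → ℝ} {P : List (Fin d → ℝ) → ℂ}
    (hP : F.HasPolyspectra Pw P) (hm : Function.Injective m) (hm' : ∀ i i', m i + m i' ≠ 0)
    (hpow : ∀ i, 0 < F.power (m i)) (q : ℕ) (θ : ι → ℝ) :
    PowerSeries.coeff q (PowerSeries.C ((2 * Real.pi : ℂ) ^ S.card) * F.phaseDensity m S θ) =
      phaseFunctional (fun i : S => θ i) (charPoly (fun i : S => F.wave (m i)) Pw P q) := by
  have hd (α : S → ℂ) : PowerSeries.coeff q (F.jointDensity m S α) =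
      densityTransform (charPoly (fun i : S => F.wave (m i)) Pw P q) α := by
    rw [jointDensity, PowerSeries.coeff_mk, densityTransform, Fintype.card_coe]
    refine integral_congr_ae (Filter.Eventually.of_forall fun ζ => ?_)
    simp only
    rw [F.coeff_charSeries m S hP hm hm' hpow, Complex.ofReal_sum, Finset.mul_sum,
      Complex.exp_sum]
    simp only [gaussWave, Finset.prod_mul_distrib]
    ring
  rw [PowerSeries.coeff_C_mul, phaseDensity, PowerSeries.coeff_mk, phaseFunctional,
    Fintype.card_coe]
  simp_rw [hd]

end BoxField

/-! ### Counting sequences with prescribed multiplicities -/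

section Counting

variable {E : Type*} [DecidableEq E] {n : ℕ}

/-- The number of times that `e` occurs in `s`. -/
def occurrences (s : Fin n → E) (e : E) : ℕ := (Finset.univ.filter fun r => s r = e).card

lemma exists_perm_of_occurrences_eq (s s₀ : Fin n → E) (h : occurrences s = occurrences s₀) :
    ∃ σ : Equiv.Perm (Fin n), s₀ ∘ σ = s := by
  have hc (e : E) : Fintype.card {r // s r = e} = Fintype.card {r // s₀ r = e} := by
    rw [Fintype.card_subtype, Fintype.card_subtype]
    exact congrFun h e
  refine ⟨Equiv.ofFiberEquiv (f := s) (g := s₀) fun e => Fintype.equivOfCardEq (hc e), ?_⟩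
  ext1 r
  exact Equiv.ofFiberEquiv_map _ r

lemma occurrences_comp_perm (s : Fin n → E) (σ : Equiv.Perm (Fin n)) :
    occurrences (s ∘ σ) = occurrences s := by
  ext e
  unfold occurrences
  rw [← Finset.card_map σ.toEmbedding]
  congr 1
  ext r
  simp only [Finset.mem_map, Finset.mem_filter, Finset.mem_univ, true_and, Function.comp_apply,
    Equiv.coe_toEmbedding]
  exact ⟨fun ⟨r', h, hr⟩ => hr ▸ h, fun h => ⟨σ.symm r, by simpa using h, by simp⟩⟩

variable [Fintype E]

lemma prod_eq_prod_pow_occurrences {M : Type*} [CommMonoid M] (s : Fin n → E) (g : E → M) :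
    ∏ r, g (s r) = ∏ e, g e ^ occurrences s e := by
  rw [← Finset.prod_fiberwise Finset.univ s]
  refine Finset.prod_congr rfl fun e _ => ?_
  rw [Finset.prod_congr rfl fun r hr => by rw [(Finset.mem_filter.mp hr).2], Finset.prod_const]
  rfl

lemma sum_eq_sum_occurrences_smul {M : Type*} [AddCommMonoid M] (s : Fin n → E) (g : E → M) :
    ∑ r, g (s r) = ∑ e, occurrences s e • g e := by
  rw [← Finset.sum_fiberwise Finset.univ s]
  refine Finset.sum_congr rfl fun e _ => ?_
  rw [Finset.sum_congr rfl fun r hr => by rw [(Finset.mem_filter.mp hr).2], Finset.sum_const]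
  rfl

lemma sum_occurrences (s : Fin n → E) : ∑ e, occurrences s e = n := by
  simpa using (sum_eq_sum_occurrences_smul s fun _ => (1 : ℕ)).symm

/-- Orbit and stabilizer: permutations act transitively on sequences with the same multiplicities,
and each fibre of `σ ↦ s₀ ∘ σ` is a translate of the stabilizer of `s₀`, of order `∏ (occurrences s₀
e)!`. -/
lemma card_occurrences_eq (s₀ : Fin n → E) :
    (Finset.univ.filter fun s : Fin n → E => occurrences s = occurrences s₀).card *
      ∏ e, (occurrences s₀ e).factorial = n.factorial := by
  have h1 : (Finset.univ : Finset (Equiv.Perm (Fin n))).card = n.factorial := by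
    rw [Finset.card_univ, Fintype.card_perm, Fintype.card_fin]
  rw [← h1, Finset.card_eq_sum_card_fiberwise (f := fun σ : Equiv.Perm (Fin n) => s₀ ∘ σ)
    (t := Finset.univ.filter fun s : Fin n → E => occurrences s = occurrences s₀)
    (fun σ _ => by simpa using occurrences_comp_perm s₀ σ)]
  rw [Finset.sum_const_nat (m := ∏ e, (occurrences s₀ e).factorial)]
  intro s hs
  obtain ⟨τ, hτ⟩ := exists_perm_of_occurrences_eq s s₀ (Finset.mem_filter.mp hs).2
  have h2 := DomMulAct.stabilizer_card s₀
  have h3 (e : E) : Fintype.card {r // s₀ r = e} = occurrences s₀ e := Fintype.card_subtype _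
  simp_rw [h3] at h2
  rw [← h2, Fintype.card_subtype]
  refine Finset.card_nbij' (fun σ => σ * τ⁻¹) (fun σ => σ * τ) ?_ ?_ ?_ ?_
  · intro σ hσ
    have hσ' : s₀ ∘ σ = s := by simpa using hσ
    simp only [Finset.coe_filter, Finset.mem_univ, true_and, Set.mem_ofPred_eq]
    rw [Equiv.Perm.coe_mul, ← Function.comp_assoc, hσ', ← hτ, Function.comp_assoc,
      ← Equiv.Perm.coe_mul]
    simp
  · intro σ hσ
    have hσ' : s₀ ∘ σ = s₀ := by simpa using hσ
    simp only [Finset.coe_filter, Finset.mem_univ, true_and, Set.mem_ofPred_eq]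
    rw [Equiv.Perm.coe_mul, ← Function.comp_assoc, hσ', hτ]
  · intro σ _; simp
  · intro σ _; simp

end Counting

/-! ### Monomials of the cumulants and the leading contribution -/

section CumulantPoly

variable {d : ℕ} {κ : Type*} [Fintype κ] [DecidableEq κ] (k : κ → Fin d → ℝ)
  (Pw : (Fin d → ℝ) → ℝ) (P : List (Fin d → ℝ) → ℂ)

lemma prod_signedCoeff {n : ℕ} (s : Fin n → κ × Bool) :
    (fun ζ : κ → ℂ => ∏ r, signedCoeff ζ (s r)) =
      ((1 / 2 : ℂ) ^ n) • mono (fun i => occurrences s (i, false))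
        fun i => occurrences s (i, true) := by
  ext ζ
  have h (e : κ × Bool) : signedCoeff ζ e =
      (1 / 2) * (if e.2 then starRingEnd ℂ (ζ e.1) else ζ e.1) := by rw [signedCoeff]; ring
  simp_rw [h]
  rw [Finset.prod_mul_distrib, Finset.prod_const, Finset.card_univ, Fintype.card_fin,
    prod_eq_prod_pow_occurrences s fun e => if e.2 then starRingEnd ℂ (ζ e.1) else ζ e.1,
    Fintype.prod_prod_type]
  simp only [Fintype.prod_bool, mono, Pi.smul_apply, smul_eq_mul, if_true, Bool.false_eq_true,
    if_false]
  congr 1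
  exact Finset.prod_congr rfl fun i _ => mul_comm _ _

/-- The normalized polyspectrum of a sequence of signed modes. -/
def modePolyspectrum {n : ℕ} (s : Fin n → κ × Bool) : ℂ :=
  normPolyspectrum Pw P (List.ofFn fun r => signedWave k (s r))

lemma cumulantPoly_eq_sum (n : ℕ) : cumulantPoly k Pw P n =
    ∑ s : Fin n → κ × Bool, ((1 / 2 : ℂ) ^ n * modePolyspectrum k Pw P s) •
      mono (fun i => occurrences s (i, false)) fun i => occurrences s (i, true) := by
  ext ζ
  rw [cumulantPoly, Finset.sum_apply]
  refine Finset.sum_congr rfl fun s _ => ?_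
  have := congrFun (prod_signedCoeff s) ζ
  simp only [Pi.smul_apply, smul_eq_mul] at this ⊢
  rw [this, modePolyspectrum]
  ring

lemma cumulantPoly_mem_polyAlg (n : ℕ) : cumulantPoly k Pw P n ∈ polyAlg κ := by
  rw [cumulantPoly_eq_sum]
  exact sum_mem fun s _ => (polyAlg κ).smul_mem (mono_mem_polyAlg _ _) _

lemma sum_signedWave {n : ℕ} (s : Fin n → κ × Bool) :
    ∑ r, signedWave k (s r) =
      ∑ i, ((occurrences s (i, true) : ℤ) - occurrences s (i, false)) • k i := by
  rw [sum_eq_sum_occurrences_smul, Fintype.sum_prod_type]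
  refine Finset.sum_congr rfl fun i _ => ?_
  rw [sub_smul, natCast_zsmul, natCast_zsmul, sub_eq_add_neg]
  simp only [Fintype.sum_bool, signedWave, if_true, Bool.false_eq_true, if_false, smul_neg]

lemma sum_occurrences_signed {n : ℕ} (s : Fin n → κ × Bool) :
    ∑ i, (occurrences s (i, true) + occurrences s (i, false)) = n := by
  have h := sum_occurrences s
  rw [Fintype.sum_prod_type] at h
  simpa only [Fintype.sum_bool] using h

lemma modePolyspectrum_eq_zero {n : ℕ} (s : Fin n → κ × Bool)
    (h : ∑ i, ((occurrences s (i, true) : ℤ) - occurrences s (i, false)) • k i ≠ 0) :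
    modePolyspectrum k Pw P s = 0 := by
  rw [modePolyspectrum, normPolyspectrum, if_neg]
  rwa [List.sum_ofFn, sum_signedWave]

lemma sum_natAbs_occurrences_le {n : ℕ} (s : Fin n → κ × Bool) :
    ∑ i, ((occurrences s (i, true) : ℤ) - occurrences s (i, false)).natAbs ≤ n := by
  conv_rhs => rw [← sum_occurrences_signed s]
  exact Finset.sum_le_sum fun i _ => by omega

/-- The polyspectrum of a sequence vanishes unless its net occupation numbers form a relation, of
total size at most `n`. If only the trivial relation is that short, each mode occurs equally often
with both signs. -/
lemma cumulantPoly_mem_neutralAlg {n : ℕ}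
    (h : ∀ c : κ → ℤ, ∑ i, c i • k i = 0 → ∑ i, (c i).natAbs ≤ n → c = 0) :
    cumulantPoly k Pw P n ∈ neutralAlg κ := by
  rw [cumulantPoly_eq_sum]
  refine sum_mem fun s _ => ?_
  by_cases hs : ∑ i, ((occurrences s (i, true) : ℤ) - occurrences s (i, false)) • k i = 0
  · have hc := h _ hs (sum_natAbs_occurrences_le s)
    have he : (fun i => occurrences s (i, false)) = fun i => occurrences s (i, true) := by
      ext i
      have := congrFun hc i
      simp only [Pi.zero_apply] at this
      omega
    rw [he]
    exact (neutralAlg κ).smul_mem (mono_self_mem_neutralAlg _) _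
  · rw [modePolyspectrum_eq_zero k Pw P s hs, mul_zero, zero_smul]
    exact zero_mem _

/-- The sequences of signed modes in which, up to order, the mode `i` with the sign of `j i`
occurs `|j i|` times. -/
def signedClass (n : ℕ) (j : κ → ℤ) : Finset (Fin n → κ × Bool) :=
  Finset.univ.filter fun s => ∀ i, occurrences s (i, true) = (j i).toNat ∧
    occurrences s (i, false) = (-j i).toNat

lemma mem_signedClass {n : ℕ} {j : κ → ℤ} {s : Fin n → κ × Bool} :
    s ∈ signedClass n j ↔ ∀ i, occurrences s (i, true) = (j i).toNat ∧
      occurrences s (i, false) = (-j i).toNat := by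
  simp [signedClass]

lemma occurrences_eq_of_mem_signedClass {n : ℕ} {j : κ → ℤ} {s s₀ : Fin n → κ × Bool}
    (hs : s ∈ signedClass n j) (hs₀ : s₀ ∈ signedClass n j) :
    occurrences s = occurrences s₀ := by
  ext ⟨i, x⟩
  cases x
  · rw [(mem_signedClass.mp hs i).2, (mem_signedClass.mp hs₀ i).2]
  · rw [(mem_signedClass.mp hs i).1, (mem_signedClass.mp hs₀ i).1]

lemma card_signedClass {n : ℕ} {j : κ → ℤ} {s₀ : Fin n → κ × Bool} (hs₀ : s₀ ∈ signedClass n j) :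
    (signedClass n j).card * ∏ i, (j i).natAbs.factorial = n.factorial := by
  rw [← card_occurrences_eq s₀, Fintype.prod_prod_type]
  congr 2
  · ext s
    simp only [Finset.mem_filter, Finset.mem_univ, true_and]
    refine ⟨fun hs => occurrences_eq_of_mem_signedClass hs hs₀, fun h => ?_⟩
    rw [mem_signedClass, h]
    exact mem_signedClass.mp hs₀
  · ext i
    rw [Fintype.prod_bool, (mem_signedClass.mp hs₀ i).1, (mem_signedClass.mp hs₀ i).2]
    rcases le_total 0 (j i) with h | h
    · rw [show (-j i).toNat = 0 by omega, show (j i).toNat = (j i).natAbs by omega]; simp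
    · rw [show (j i).toNat = 0 by omega, show (-j i).toNat = (j i).natAbs by omega]; simp

lemma phaseTransform_toNat (j : ℤ) (θ : ℝ) : phaseTransform (-j).toNat j.toNat θ =
    (2 * Complex.I) ^ j.natAbs * Real.Gamma (1 + j.natAbs / 2) *
      Complex.exp (-Complex.I * (j * θ)) := by
  rcases le_total 0 j with h | h
  · rw [show (-j).toNat = 0 by omega, show j.toNat = j.natAbs by omega, phaseTransform_zero_left]
    have : ((j.natAbs : ℕ) : ℂ) = (j : ℂ) := by
      rw [← Int.cast_natCast, Int.natAbs_of_nonneg h]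
    rw [this]
  · rw [show j.toNat = 0 by omega, show (-j).toNat = j.natAbs by omega, phaseTransform_zero_right]
    have : ((j.natAbs : ℕ) : ℂ) = -(j : ℂ) := by
      rw [← Int.cast_natCast, Int.ofNat_natAbs_of_nonpos h, Int.cast_neg]
    rw [this]
    congr 2; ring

lemma phaseFunctional_mono_signedClass {n : ℕ} {j : κ → ℤ} {s : Fin n → κ × Bool}
    (hs : s ∈ signedClass n j) (θ : κ → ℝ) :
    phaseFunctional θ (mono (fun i => occurrences s (i, false))
      fun i => occurrences s (i, true)) =
      (2 * Complex.I) ^ n * (∏ i, Real.Gamma (1 + (j i).natAbs / 2) : ℝ) *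
        Complex.exp (-Complex.I * ((∑ i, j i * θ i : ℝ) : ℂ)) := by
  have hn : ∑ i, (j i).natAbs = n := by
    conv_rhs => rw [← sum_occurrences_signed s]
    refine Finset.sum_congr rfl fun i _ => ?_
    rw [(mem_signedClass.mp hs i).1, (mem_signedClass.mp hs i).2]; omega
  rw [phaseFunctional_mono, Finset.prod_congr rfl fun i _ => by
    rw [(mem_signedClass.mp hs i).1, (mem_signedClass.mp hs i).2, phaseTransform_toNat],
    Finset.prod_mul_distrib, Finset.prod_mul_distrib, Finset.prod_pow_eq_pow_sum, hn,
    ← Complex.exp_sum, ← Finset.mul_sum]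
  push_cast
  rfl

lemma modePolyspectrum_signedClass {n : ℕ} {j : κ → ℤ} {s s₀ : Fin n → κ × Bool}
    (hs : s ∈ signedClass n j) (hs₀ : s₀ ∈ signedClass n j)
    (hsym : ∀ (s : Fin n → κ × Bool) (σ : Equiv.Perm (Fin n)),
      modePolyspectrum k Pw P (s ∘ σ) = modePolyspectrum k Pw P s) :
    modePolyspectrum k Pw P s = modePolyspectrum k Pw P s₀ := by
  obtain ⟨σ, hσ⟩ := exists_perm_of_occurrences_eq s s₀ (occurrences_eq_of_mem_signedClass hs hs₀)
  rw [← hσ, hsym]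

lemma sum_signedClass {n : ℕ} {j : κ → ℤ} {s₀ : Fin n → κ × Bool}
    (hs₀ : s₀ ∈ signedClass n j)
    (hsym : ∀ (s : Fin n → κ × Bool) (σ : Equiv.Perm (Fin n)),
      modePolyspectrum k Pw P (s ∘ σ) = modePolyspectrum k Pw P s) (θ : κ → ℝ) :
    ∑ s ∈ signedClass n j, ((1 / 2 : ℂ) ^ n * modePolyspectrum k Pw P s) *
      phaseFunctional θ (mono (fun i => occurrences s (i, false))
        fun i => occurrences s (i, true)) =
      Complex.I ^ n * n.factorial *
        (∏ i, Real.Gamma (1 + (j i).natAbs / 2) / (j i).natAbs.factorial : ℝ) *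
        Complex.exp (-Complex.I * ((∑ i, j i * θ i : ℝ) : ℂ)) *
        modePolyspectrum k Pw P s₀ := by
  have h1 : ∀ s ∈ signedClass n j, ((1 / 2 : ℂ) ^ n * modePolyspectrum k Pw P s) *
      phaseFunctional θ (mono (fun i => occurrences s (i, false))
        fun i => occurrences s (i, true)) =
      Complex.I ^ n * (∏ i, Real.Gamma (1 + (j i).natAbs / 2) : ℝ) *
        Complex.exp (-Complex.I * ((∑ i, j i * θ i : ℝ) : ℂ)) *
        modePolyspectrum k Pw P s₀ := by
    intro s hs
    rw [phaseFunctional_mono_signedClass hs, modePolyspectrum_signedClass k Pw P hs hs₀ hsym]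
    have : (1 / 2 : ℂ) ^ n * (2 * Complex.I) ^ n = Complex.I ^ n := by
      rw [← mul_pow]; congr 1; ring
    rw [← this]; ring
  rw [Finset.sum_congr rfl h1, Finset.sum_const, nsmul_eq_mul, Finset.prod_div_distrib]
  have h2 : ((signedClass n j).card : ℂ) * (∏ i, ((j i).natAbs.factorial : ℝ) : ℝ) =
      n.factorial := by
    rw [← card_signedClass hs₀]; push_cast; rfl
  have h3 : ((∏ i, ((j i).natAbs.factorial : ℝ) : ℝ) : ℂ) ≠ 0 := by
    rw [Complex.ofReal_ne_zero]
    exact Finset.prod_ne_zero_iff.mpr fun i _ => by positivity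
  rw [← h2, Complex.ofReal_div]
  field_simp

/-- Equality case of `|x - y| ≤ x + y`: the length `n` leaves no room for cancelling pairs, so each
mode occurs with one sign only. -/
lemma mem_signedClass_of_sub_eq {n : ℕ} {j : κ → ℤ} {s : Fin n → κ × Bool}
    (hn : ∑ i, (j i).natAbs = n)
    (h : ∀ i, (occurrences s (i, true) : ℤ) - occurrences s (i, false) = j i) :
    s ∈ signedClass n j := by
  have h1 : ∑ i, (j i).natAbs = ∑ i, (occurrences s (i, true) + occurrences s (i, false)) := by
    rw [sum_occurrences_signed, hn]
  rw [Finset.sum_eq_sum_iff_of_le fun i _ => by have := h i; omega] at h1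
  rw [mem_signedClass]
  intro i
  have h2 := h1 i (Finset.mem_univ i)
  have h3 := h i
  omega

/-- Sequences are sorted by the multiple `t` in their relation `t j`. The classes `t = 1` and `t =
-1` give conjugate exponentials with equal coefficients, by `hpar`; every other sequence contributes
zero. -/
lemma phaseFunctional_cumulantPoly {n : ℕ} (hn0 : n ≠ 0) {j : κ → ℤ}
    (hn : ∑ i, (j i).natAbs = n)
    (hrel : ∀ c : κ → ℤ, ∑ i, c i • k i = 0 → ∃ t : ℤ, c = t • j)
    {s₀ s₁ : Fin n → κ × Bool} (hs₀ : s₀ ∈ signedClass n j) (hs₁ : s₁ ∈ signedClass n (-j))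
    (hpar : modePolyspectrum k Pw P s₁ = modePolyspectrum k Pw P s₀)
    (hsym : ∀ (s : Fin n → κ × Bool) (σ : Equiv.Perm (Fin n)),
      modePolyspectrum k Pw P (s ∘ σ) = modePolyspectrum k Pw P s) (θ : κ → ℝ) :
    phaseFunctional θ (cumulantPoly k Pw P n) =
      Complex.I ^ n * n.factorial *
        ((2 * (∏ i, Real.Gamma (1 + (j i).natAbs / 2) / (j i).natAbs.factorial) *
          Real.cos (∑ i, j i * θ i) : ℝ) : ℂ) * modePolyspectrum k Pw P s₀ := by
  set f : (Fin n → κ × Bool) → ℂ := fun s => ((1 / 2 : ℂ) ^ n * modePolyspectrum k Pw P s) *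
      phaseFunctional θ (mono (fun i => occurrences s (i, false))
        fun i => occurrences s (i, true)) with hf
  have h1 : phaseFunctional θ (cumulantPoly k Pw P n) = ∑ s, f s := by
    rw [cumulantPoly_eq_sum, phaseFunctional_sum _ _ fun s _ =>
      (polyAlg κ).smul_mem (mono_mem_polyAlg _ _) _]
    exact Finset.sum_congr rfl fun s _ => phaseFunctional_smul _ _ _
  have hdisj : Disjoint (signedClass n j) (signedClass n (-j)) := by
    rw [Finset.disjoint_left]
    intro s hs hs'
    refine hn0 (hn ▸ Finset.sum_eq_zero fun i _ => ?_)
    have h2 := (mem_signedClass.mp hs i).1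
    have h3 := (mem_signedClass.mp hs i).2
    have h4 := (mem_signedClass.mp hs' i).1
    have h5 := (mem_signedClass.mp hs' i).2
    simp only [Pi.neg_apply] at h4 h5
    omega
  have h2 : ∑ s, f s = ∑ s ∈ signedClass n j ∪ signedClass n (-j), f s := by
    refine (Finset.sum_subset (Finset.subset_univ _) fun s _ hs => ?_).symm
    by_cases hz : ∑ i, ((occurrences s (i, true) : ℤ) - occurrences s (i, false)) • k i = 0
    · obtain ⟨t, ht⟩ := hrel _ hz
      have hti (i) : (occurrences s (i, true) : ℤ) - occurrences s (i, false) = t * j i :=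
        congrFun ht i
      -- A sequence of length `n = ∑ |j i|` cannot carry a relation longer than `n`, which forces
      -- `|t| ≤ 1`.
      have hle : t.natAbs * n ≤ n := by
        calc t.natAbs * n = ∑ i, (t * j i).natAbs := by
              simp only [Int.natAbs_mul, ← Finset.mul_sum, hn]
          _ ≤ n := by simpa only [hti] using sum_natAbs_occurrences_le s
      have ht1 : t.natAbs ≤ 1 := by
        by_contra hc
        have : 2 * n ≤ t.natAbs * n := Nat.mul_le_mul_right n (by omega)
        omega
      rw [Finset.mem_union, not_or] at hs
      obtain rfl | rfl | rfl : t = 0 ∨ t = 1 ∨ t = -1 := by omega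
      -- For `t = 0` the monomial is neutral and, as `n ≠ 0`, not constant; its value at the origin
      -- is zero.
      · have he : (fun i => occurrences s (i, false)) = fun i => occurrences s (i, true) := by
          ext i
          have := hti i
          omega
        have hmono : mono (fun i => occurrences s (i, true)) (fun i => occurrences s (i, true))
            (0 : κ → ℂ) = 0 := by
          obtain ⟨i, hi⟩ : ∃ i, occurrences s (i, true) ≠ 0 := by
            by_contra! hc
            apply hn0
            rw [← sum_occurrences_signed s]
            refine Finset.sum_eq_zero fun i _ => ?_
            have := congrFun he i
            simp only [hc] at this ⊢
            omega
          exact Finset.prod_eq_zero (Finset.mem_univ i) (by simp [hi])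
        rw [hf]
        simp only [he]
        rw [phaseFunctional_neutral (mono_self_mem_neutralAlg _), hmono, mul_zero]
      · exact absurd (mem_signedClass_of_sub_eq hn fun i => by rw [hti, one_mul]) hs.1
      · exact absurd (mem_signedClass_of_sub_eq (by simpa using hn) fun i => by
          rw [hti, neg_one_mul]; rfl) hs.2
    · rw [hf]
      simp only [modePolyspectrum_eq_zero k Pw P s hz, mul_zero, zero_mul]
  rw [h1, h2, Finset.sum_union hdisj, sum_signedClass k Pw P hs₀ hsym θ,
    sum_signedClass k Pw P hs₁ hsym θ, hpar]
  simp only [Pi.neg_apply, Int.natAbs_neg, Int.cast_neg, neg_mul, Finset.sum_neg_distrib]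
  have hcos : ((Real.cos (∑ i, j i * θ i) : ℝ) : ℂ) =
      (Complex.exp (Complex.I * ((∑ i, j i * θ i : ℝ) : ℂ)) +
        Complex.exp (-(Complex.I * ((∑ i, j i * θ i : ℝ) : ℂ)))) / 2 := by
    rw [Complex.ofReal_cos, Complex.cos]
    ring_nf
  rw [Complex.ofReal_mul _ (Real.cos _), hcos, Complex.ofReal_mul]
  push_cast
  ring_nf

end CumulantPoly

/-! ### Permutation symmetry, parity, a representative sequence and truncation -/

lemma normPolyspectrum_eq_of_perm {d : ℕ} (Pw : (Fin d → ℝ) → ℝ) {P : List (Fin d → ℝ) → ℂ}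
    {l l' : List (Fin d → ℝ)} (h : l.Perm l') (hP : l.sum = 0 → P l = P l') :
    normPolyspectrum Pw P l = normPolyspectrum Pw P l' := by
  rw [normPolyspectrum, normPolyspectrum, h.sum_eq, (h.map Pw).prod_eq]
  split_ifs with h0
  · rw [hP (by rw [h.sum_eq, h0])]
  · rfl

/-- Symmetry of `P` is not assumed: on wavevectors of a box it is inherited from the joint cumulant,
after division by the nonzero power of the volume. -/
lemma BoxField.modePolyspectrum_comp_perm {d : ℕ} {κ : Type*} (F : BoxField d)
    {Pw : (Fin d → ℝ) → ℝ} {P : List (Fin d → ℝ) → ℂ} (hP : F.HasPolyspectra Pw P)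
    (m : κ → Fin d → ℤ) {n : ℕ} (hn : 3 ≤ n) (s : Fin n → κ × Bool) (σ : Equiv.Perm (Fin n)) :
    modePolyspectrum (fun i => F.wave (m i)) Pw P (s ∘ σ) =
      modePolyspectrum (fun i => F.wave (m i)) Pw P s := by
  have hw (s : Fin n → κ × Bool) : (fun r => signedWave (fun i => F.wave (m i)) (s r)) =
      fun r => F.wave (signedWave m (s r)) :=
    funext fun r => (signedWave_map F.waveHom m (s r)).symm
  have hperm : (List.ofFn fun r => F.wave (signedWave m ((s ∘ σ) r))).Perm
      (List.ofFn fun r => F.wave (signedWave m (s r))) :=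
    σ.ofFn_comp_perm fun r => F.wave (signedWave m (s r))
  rw [modePolyspectrum, modePolyspectrum, hw, hw]
  refine normPolyspectrum_eq_of_perm Pw hperm fun h0 => ?_
  rw [List.sum_ofFn] at h0
  have h1 : ∑ r, signedWave m ((s ∘ σ) r) = 0 := by
    apply F.wave_injective
    exact ((map_sum F.waveHom _ _).trans h0).trans F.waveHom.map_zero.symm
  have h2 : ∑ r, signedWave m (s r) = 0 := by
    rw [← h1]
    exact (Equiv.sum_comp σ fun r => signedWave m (s r)).symm
  have h3 := F.jointCumulant_of_hasPolyspectra hP hn _ h1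
  have h4 := F.jointCumulant_of_hasPolyspectra hP hn _ h2
  have h5 := jointCumulant_comp_perm (μ := F.μ) (fun r => F.fourierMode (signedWave m (s r))) σ
  simp only [Function.comp_apply] at h3 h5
  rw [h3, h4] at h5
  have h6 : ((F.vol ^ (1 - (n : ℝ) / 2) : ℝ) : ℂ) ≠ 0 := by
    exact_mod_cast (Real.rpow_pos_of_pos F.vol_pos _).ne'
  exact mul_left_cancel₀ h6 h5

lemma modePolyspectrum_flip {d : ℕ} {κ : Type*} (k : κ → Fin d → ℝ) {Pw : (Fin d → ℝ) → ℝ}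
    {P : List (Fin d → ℝ) → ℂ}
    (hparity : ∀ l : List (Fin d → ℝ), l.sum = 0 → P (l.map fun q => -q) = P l)
    (hPw : ∀ i, Pw (-k i) = Pw (k i)) {n : ℕ} (s : Fin n → κ × Bool) :
    modePolyspectrum k Pw P (fun r => ((s r).1, !(s r).2)) = modePolyspectrum k Pw P s := by
  have h1 (e : κ × Bool) : signedWave k (e.1, !e.2) = -signedWave k e := by
    obtain ⟨i, x⟩ := e
    cases x <;> simp [signedWave]
  have h2 (e : κ × Bool) : Pw (-signedWave k e) = Pw (signedWave k e) := by
    obtain ⟨i, x⟩ := e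
    cases x <;> simp [signedWave, hPw]
  have h3 : (List.ofFn fun r => signedWave k ((s r).1, !(s r).2)) =
      (List.ofFn fun r => signedWave k (s r)).map fun q => -q := by
    rw [List.map_ofFn]
    congr 1
    exact funext fun r => h1 (s r)
  have h4 : (List.ofFn fun r => signedWave k ((s r).1, !(s r).2)).sum =
      -(List.ofFn fun r => signedWave k (s r)).sum := by
    rw [List.sum_ofFn, List.sum_ofFn, ← Finset.sum_neg_distrib]
    exact Finset.sum_congr rfl fun r _ => h1 (s r)
  have h5 : ((List.ofFn fun r => signedWave k ((s r).1, !(s r).2)).map Pw).prod =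
      ((List.ofFn fun r => signedWave k (s r)).map Pw).prod := by
    rw [List.map_ofFn, List.map_ofFn, List.prod_ofFn, List.prod_ofFn]
    refine Finset.prod_congr rfl fun r _ => ?_
    simp only [Function.comp_apply]
    rw [h1, h2]
  rw [modePolyspectrum, modePolyspectrum, normPolyspectrum, normPolyspectrum, h4, h5]
  simp only [neg_eq_zero]
  split_ifs with h0
  · rw [h3, hparity _ h0]
  · rfl

/-- Provides a representative whose list of wavevectors is literally `signedCopies j k`, so that the
common polyspectrum of the class is the one displayed in the theorem. -/
lemma exists_mem_signedClass {d N : ℕ} (j : Fin N → ℤ) (hj : ∀ i, j i ≠ 0)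
    (k : Fin N → Fin d → ℝ) (J : ℕ) (hJ : J = ∑ i, (j i).natAbs) :
    ∃ s : Fin J → ↥(Finset.univ : Finset (Fin N)) × Bool,
      s ∈ signedClass J (fun i : ↥(Finset.univ : Finset (Fin N)) => j i) ∧
      (List.ofFn fun r => signedWave (fun i : ↥(Finset.univ : Finset (Fin N)) => k i) (s r)) =
        signedCopies j k := by
  set l : List (↥(Finset.univ : Finset (Fin N)) × Bool) := (List.finRange N).flatMap fun i =>
    List.replicate (j i).natAbs (⟨i, Finset.mem_univ i⟩, decide (0 < j i)) with hl
  have hlen : l.length = J := by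
    rw [hJ, hl, List.length_flatMap, Fin.sum_univ_def]
    simp
  clear_value l
  subst hlen
  refine ⟨fun r => l.get r, ?_, ?_⟩
  · have hocc (e) : occurrences (fun r => l.get r) e =
        ∑ i : Fin N, (j i).natAbs * if (⟨i, Finset.mem_univ i⟩, decide (0 < j i)) = e
          then 1 else 0 := by
      rw [occurrences, Finset.card_filter, ← List.sum_ofFn]
      simp only [List.get_eq_getElem]
      rw [List.ofFn_getElem_eq_map l
        (fun e' => if e' = e then 1 else 0), hl, List.map_flatMap, List.flatMap_def,
        List.sum_flatten, List.map_map,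
        Fin.sum_univ_def]
      congr 1
      refine List.map_congr_left fun i _ => ?_
      rw [Function.comp_apply, List.map_replicate, List.sum_replicate, smul_eq_mul]
    rw [mem_signedClass]
    intro i
    have hi := hj i
    rw [hocc, hocc, Finset.sum_eq_single (i : Fin N), Finset.sum_eq_single (i : Fin N)]
    · rcases lt_or_gt_of_ne hi with h | h
      · simp [h.not_gt]; omega
      · simp [h]; omega
    all_goals simp
    all_goals exact fun b hb h => absurd (congrArg Subtype.val h) hb
  · simp only [List.get_eq_getElem]
    rw [List.ofFn_getElem_eq_map l
      (signedWave fun i : ↥(Finset.univ : Finset (Fin N)) => k i), hl, List.map_flatMap, signedCopies]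
    congr 1
    ext1 i
    rw [List.map_replicate]
    congr 1
    rcases lt_or_gt_of_ne (hj i) with h | h
    · simp [signedWave, h.not_gt, Int.sign_eq_neg_one_of_neg h]
    · simp [signedWave, h, Int.sign_eq_one_of_pos h]

/-- After removal of the leading term every surviving index satisfies `q ≥ J - 1`, and for `V ≥ 1`
each such power of `V` is at most `V^{(1-J)/2}`. -/
lemma norm_truncated_sub_le {c : ℕ → ℂ} {B : ℕ → ℝ} (hB : ∀ q, ‖c q‖ ≤ B q) {J M : ℕ}
    (hJ : 2 ≤ J) (hM : J - 2 ≤ M) (hc : ∀ q < J - 2, c q = 0) {V : ℝ} (hV : 1 ≤ V) :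
    ‖(∑ q ∈ Finset.range (M + 1), c q * ((V ^ (-(q : ℝ) / 2) : ℝ) : ℂ)) -
      c (J - 2) * ((V ^ ((2 - (J : ℝ)) / 2) : ℝ) : ℂ)‖ ≤
      (∑ q ∈ Finset.range (M + 1), B q) * V ^ ((1 - (J : ℝ)) / 2) := by
  have h0 : (-((J - 2 : ℕ) : ℝ) / 2) = (2 - (J : ℝ)) / 2 := by
    rw [Nat.cast_sub hJ]; push_cast; ring
  rw [← Finset.add_sum_erase _ _ (Finset.mem_range.mpr (show J - 2 < M + 1 by omega)), h0,
    add_sub_cancel_left]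
  have hB0 (q) : 0 ≤ B q := (norm_nonneg _).trans (hB q)
  have hVp : 0 ≤ V ^ ((1 - (J : ℝ)) / 2) := Real.rpow_nonneg (by linarith) _
  calc _ ≤ ∑ q ∈ (Finset.range (M + 1)).erase (J - 2), B q * V ^ ((1 - (J : ℝ)) / 2) := by
        refine norm_sum_le_of_le _ fun q hq => ?_
        rcases lt_or_ge q (J - 2) with h | h
        · rw [hc q h, zero_mul, norm_zero]
          exact mul_nonneg (hB0 q) hVp
        · have hq' : J ≤ q + 1 := by have := (Finset.mem_erase.mp hq).1; omega
          rw [norm_mul, Complex.norm_real, Real.norm_of_nonneg (Real.rpow_nonneg (by linarith) _)]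
          refine mul_le_mul (hB q) (Real.rpow_le_rpow_of_exponent_le hV ?_)
            (Real.rpow_nonneg (by linarith) _) (hB0 q)
          have : (J : ℝ) ≤ q + 1 := by exact_mod_cast hq'
          linarith
    _ ≤ ∑ q ∈ Finset.range (M + 1), B q * V ^ ((1 - (J : ℝ)) / 2) :=
        Finset.sum_le_sum_of_subset_of_nonneg (Finset.erase_subset _ _)
          fun q _ _ => mul_nonneg (hB0 q) hVp
    _ = _ := by rw [Finset.sum_mul]

/-! ### Integer relations among subsets of the wavevectors -/

section Relations

variable {d N : ℕ} {k : Fin N → Fin d → ℝ} {j : Fin N → ℤ}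

/-- Extend the relation by zero. The last clause forces `t = 0` when `S` omits an index, since `j`
has no zero entry. -/
lemma exists_multiple_of_relation
    (hrel : ∀ c : Fin N → ℤ, ∑ i, c i • k i = 0 ↔ ∃ t : ℤ, c = t • j) (S : Finset (Fin N))
    (c : S → ℤ) (hc : ∑ i, c i • k i = 0) :
    ∃ t : ℤ, (∀ i : S, c i = t * j i) ∧ ∀ i ∉ S, t * j i = 0 := by
  obtain ⟨t, ht⟩ := (hrel fun i => if h : i ∈ S then c ⟨i, h⟩ else 0).mp (by
    rw [← hc, ← Finset.sum_subset (Finset.subset_univ S) fun i _ hi => by rw [dif_neg hi, zero_smul],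
      ← Finset.sum_coe_sort S]
    exact Finset.sum_congr rfl fun i _ => by rw [dif_pos i.2])
  refine ⟨t, fun i => ?_, fun i hi => ?_⟩
  · have := congrFun ht i
    simpa using this
  · have := congrFun ht i
    simpa [hi] using this.symm

end Relations

/-! ### Assembly of the reduced phase function -/

section ReducedPhase

variable {d N : ℕ} {U : Set (Fin d → ℝ)} {k : Fin N → Fin d → ℝ} {j : Fin N → ℤ}
  {Pw : (Fin d → ℝ) → ℝ} {P : List (Fin d → ℝ) → ℂ}

lemma add_ne_zero_of_mem_upperHalf (hU : IsUpperHalf U) (hkU : ∀ i, k i ∈ U) (i i' : Fin N) :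
    k i + k i' ≠ 0 := fun h =>
  hU.neg_notMem _ (hkU i) (by rw [neg_eq_of_add_eq_zero_right h]; exact hkU i')

/-- A smaller sum leaves only two modes with coefficients `±1`, that is `k 0 = ± k 1`, excluded by
distinctness and the half space. The bound is needed because the polyspectra start at order three.
-/
lemma three_le_sum_natAbs (hN : 2 ≤ N) (hU : IsUpperHalf U) (hkU : ∀ i, k i ∈ U)
    (hk : Function.Injective k) (hj : ∀ i, j i ≠ 0)
    (hrel : ∀ c : Fin N → ℤ, ∑ i, c i • k i = 0 ↔ ∃ t : ℤ, c = t • j) :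
    3 ≤ ∑ i, (j i).natAbs := by
  have h1 (i) : 1 ≤ (j i).natAbs := Nat.one_le_iff_ne_zero.mpr (Int.natAbs_ne_zero.mpr (hj i))
  by_contra! hc
  have hle : ∑ _i : Fin N, 1 ≤ ∑ i, (j i).natAbs := Finset.sum_le_sum fun i _ => h1 i
  have hN2 : N = 2 := by
    simp only [Finset.sum_const, Finset.card_univ, Fintype.card_fin, smul_eq_mul, mul_one] at hle
    omega
  subst hN2
  have hrel' := (hrel j).mpr ⟨1, (one_smul _ _).symm⟩
  rw [Fin.sum_univ_two] at hrel' hc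
  have h0 := h1 0
  have h1' := h1 1
  have hadd := add_ne_zero_of_mem_upperHalf hU hkU (0 : Fin 2) 1
  have hne : k 0 ≠ k 1 := fun h => absurd (hk h) (by decide)
  obtain h2 | h2 : j 0 = 1 ∨ j 0 = -1 := by omega
  all_goals obtain h3 | h3 : j 1 = 1 ∨ j 1 = -1 := by omega
  all_goals rw [h2, h3] at hrel'; simp only [one_smul, neg_smul] at hrel'
  · exact hadd hrel'
  · exact hne (add_neg_eq_zero.mp hrel')
  · exact hne (neg_add_eq_zero.mp hrel')
  · exact hadd (by rwa [← neg_add, neg_eq_zero] at hrel')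

lemma cumulantPoly_mem_neutralAlg_of_proper (hj : ∀ i, j i ≠ 0)
    (hrel : ∀ c : Fin N → ℤ, ∑ i, c i • k i = 0 ↔ ∃ t : ℤ, c = t • j) {S : Finset (Fin N)}
    (hS : S ⊂ Finset.univ) (n : ℕ) :
    cumulantPoly (fun i : S => k i) Pw P n ∈ neutralAlg S := by
  refine cumulantPoly_mem_neutralAlg _ _ _ fun c hc _ => ?_
  obtain ⟨t, ht, ht0⟩ := exists_multiple_of_relation hrel S c hc
  obtain ⟨i, -, hi⟩ := Finset.exists_of_ssubset hS
  have : t = 0 := (mul_eq_zero.mp (ht0 i hi)).resolve_right (hj i)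
  ext i
  rw [ht, this, zero_mul]; rfl

lemma cumulantPoly_mem_neutralAlg_of_lt
    (hrel : ∀ c : Fin N → ℤ, ∑ i, c i • k i = 0 ↔ ∃ t : ℤ, c = t • j) {n : ℕ}
    (hn : n < ∑ i, (j i).natAbs) :
    cumulantPoly (fun i : ↥(Finset.univ : Finset (Fin N)) => k i) Pw P n ∈
      neutralAlg ↥(Finset.univ : Finset (Fin N)) := by
  refine cumulantPoly_mem_neutralAlg _ _ _ fun c hc hle => ?_
  obtain ⟨t, ht, -⟩ := exists_multiple_of_relation hrel _ c hc
  have h1 : t.natAbs * ∑ i, (j i).natAbs ≤ n := by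
    refine le_trans (le_of_eq ?_) hle
    rw [Finset.mul_sum, ← Finset.sum_coe_sort]
    exact Finset.sum_congr rfl fun i _ => by rw [ht, Int.natAbs_mul]
  have h2 : t = 0 := by
    by_contra h0
    have := Nat.mul_le_mul_right (∑ i, (j i).natAbs) (Int.natAbs_pos.mpr h0)
    omega
  ext i
  rw [ht, h2, zero_mul]; rfl

lemma charPoly_mem {κ : Type*} [Fintype κ] {k : κ → Fin d → ℝ}
    (B : Subalgebra ℂ ((κ → ℂ) → ℂ)) {q : ℕ}
    (h : ∀ l, 1 ≤ l → l ≤ q → cumulantPoly k Pw P (l + 2) ∈ B) : charPoly k Pw P q ∈ B :=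
  coeff_exp_subst_mem B (constantCoeff_polySeries k Pw P) fun l hl =>
    coeff_polySeries_mem k Pw P B fun h1 => h l h1 hl

variable (F : BoxField d) {m : Fin N → Fin d → ℤ}

/-- For proper subsets every cumulant is neutral, so their normalized densities equal one and
`reducedPart_eq_sub_one` applies. -/
lemma BoxField.reducedPhase_eq (hP : F.HasPolyspectra Pw P) (hN : 2 ≤ N)
    (hm : ∀ i, F.wave (m i) = k i) (hU : IsUpperHalf U) (hkU : ∀ i, k i ∈ U)
    (hk : Function.Injective k) (hj : ∀ i, j i ≠ 0)
    (hrel : ∀ c : Fin N → ℤ, ∑ i, c i • k i = 0 ↔ ∃ t : ℤ, c = t • j)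
    (hPw : ∀ i, 0 < Pw (k i)) (q : ℕ) (θ : Fin N → ℝ) :
    PowerSeries.coeff q (F.reducedPhase m θ) =
      phaseFunctional (fun i : ↥(Finset.univ : Finset (Fin N)) => θ i)
        (charPoly (fun i : ↥(Finset.univ : Finset (Fin N)) => k i) Pw P q) -
        if q = 0 then 1 else 0 := by
  have hminj : Function.Injective m := fun i i' h => hk (by rw [← hm, ← hm, h])
  have hmadd (i i') : m i + m i' ≠ 0 := fun h =>
    add_ne_zero_of_mem_upperHalf hU hkU i i' (by
      rw [← hm, ← hm]
      exact ((F.waveHom.map_add _ _).symm.trans (congrArg F.wave h)).trans F.waveHom.map_zero)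
  have hpow (i) : 0 < F.power (m i) := by rw [hP.1, hm]; exact hPw i
  have hcoeff (S : Finset (Fin N)) (q : ℕ) :
      PowerSeries.coeff q (PowerSeries.C ((2 * Real.pi : ℂ) ^ S.card) * F.phaseDensity m S θ) =
      phaseFunctional (fun i : S => θ i) (charPoly (fun i : S => k i) Pw P q) := by
    rw [F.coeff_phaseDensity m S hP hminj hmadd hpow]
    simp_rw [hm]
  rw [reducedPhase, reducedPart_eq_sub_one _ _ (by simpa using hN), map_sub, hcoeff,
    PowerSeries.coeff_one]
  intro S hS
  ext q
  rw [hcoeff, phaseFunctional_neutral (charPoly_mem _ fun l _ _ =>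
    cumulantPoly_mem_neutralAlg_of_proper hj hrel hS _), charPoly_zero, PowerSeries.coeff_one]

lemma phaseFunctional_charPoly_of_lt
    (hrel : ∀ c : Fin N → ℤ, ∑ i, c i • k i = 0 ↔ ∃ t : ℤ, c = t • j) {q : ℕ}
    (hq : q + 2 < ∑ i, (j i).natAbs) (θ : ↥(Finset.univ : Finset (Fin N)) → ℝ) :
    phaseFunctional θ (charPoly (fun i : ↥(Finset.univ : Finset (Fin N)) => k i) Pw P q) =
      if q = 0 then 1 else 0 := by
  rw [phaseFunctional_neutral (charPoly_mem _ fun l _ hl =>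
    cumulantPoly_mem_neutralAlg_of_lt hrel (by omega)), charPoly_zero]

/-- Beyond its linear term in the cumulant of order `q + 2`, the coefficient is neutral and vanishes
at `ζ = 0`, so the functional kills the difference. -/
lemma phaseFunctional_charPoly_leading
    (hrel : ∀ c : Fin N → ℤ, ∑ i, c i • k i = 0 ↔ ∃ t : ℤ, c = t • j) {q : ℕ} (hq1 : 1 ≤ q)
    (hq : q + 2 = ∑ i, (j i).natAbs) (θ : ↥(Finset.univ : Finset (Fin N)) → ℝ) :
    phaseFunctional θ (charPoly (fun i : ↥(Finset.univ : Finset (Fin N)) => k i) Pw P q) =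
      (-Complex.I) ^ (q + 2) / ((q + 2).factorial : ℂ) * phaseFunctional θ
        (cumulantPoly (fun i : ↥(Finset.univ : Finset (Fin N)) => k i) Pw P (q + 2)) := by
  set k' := fun i : ↥(Finset.univ : Finset (Fin N)) => k i
  have h1 := coeff_exp_subst_sub_mem (neutralAlg _) (constantCoeff_polySeries k' Pw P) hq1
    fun l hl => coeff_polySeries_mem k' Pw P _ fun _ =>
      cumulantPoly_mem_neutralAlg_of_lt hrel (by omega)
  rw [coeff_polySeries k' Pw P hq1] at h1
  change charPoly k' Pw P q - _ ∈ _ at h1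
  have h2 : ((-Complex.I) ^ (q + 2) / ((q + 2).factorial : ℂ)) • cumulantPoly k' Pw P (q + 2) ∈
      polyAlg _ := (polyAlg _).smul_mem (cumulantPoly_mem_polyAlg k' Pw P _) _
  rw [← phaseFunctional_smul, ← sub_add_cancel (charPoly k' Pw P q)
    (((-Complex.I) ^ (q + 2) / ((q + 2).factorial : ℂ)) • cumulantPoly k' Pw P (q + 2)),
    phaseFunctional_add (neutralAlg_le_polyAlg h1) h2, phaseFunctional_neutral h1]
  have h3 := charPoly_zero k' Pw P q
  rw [if_neg (by omega)] at h3
  have h4 := cumulantPoly_zero k' Pw P (n := q + 2) (by omega)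
  simp only [Pi.sub_apply, Pi.smul_apply, h4, smul_zero, sub_zero]
  rw [h3, zero_add]

lemma BoxField.phaseFunctional_cumulantPoly_eq (hP : F.HasPolyspectra Pw P)
    (hparity : ∀ l : List (Fin d → ℝ), l.sum = 0 → P (l.map fun q => -q) = P l)
    (hm : ∀ i, F.wave (m i) = k i) (hj : ∀ i, j i ≠ 0)
    (hrel : ∀ c : Fin N → ℤ, ∑ i, c i • k i = 0 ↔ ∃ t : ℤ, c = t • j) {J : ℕ} (hJ3 : 3 ≤ J)
    (hJ : J = ∑ i, (j i).natAbs) (θ : Fin N → ℝ) :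
    phaseFunctional (fun i : ↥(Finset.univ : Finset (Fin N)) => θ i)
      (cumulantPoly (fun i : ↥(Finset.univ : Finset (Fin N)) => k i) Pw P J) =
      Complex.I ^ J * J.factorial *
        ((2 * (∏ i, Real.Gamma (1 + ((j i).natAbs : ℝ) / 2) / ((j i).natAbs.factorial : ℝ)) *
          Real.cos (∑ i, (j i : ℝ) * θ i) : ℝ) : ℂ) *
        normPolyspectrum Pw P (signedCopies j k) := by
  obtain ⟨s, hs, hsl⟩ := exists_mem_signedClass j hj k J hJ
  have hk : (fun i : ↥(Finset.univ : Finset (Fin N)) => k i) =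
      fun i : ↥(Finset.univ : Finset (Fin N)) => F.wave (m i) :=
    funext fun i => (hm i).symm
  have hflip : modePolyspectrum (fun i : ↥(Finset.univ : Finset (Fin N)) => k i) Pw P
      (fun r => ((s r).1, !(s r).2)) =
      modePolyspectrum (fun i : ↥(Finset.univ : Finset (Fin N)) => k i) Pw P s := by
    refine modePolyspectrum_flip _ hparity (fun i => ?_) s
    -- Evenness of `Pw` at the given wavevectors follows from reality of the field.
    rw [← hm, ← hP.1, ← F.power_neg, hP.1]
    exact congrArg Pw (F.waveHom.map_neg _).symm
  have hs' : (fun r => ((s r).1, !(s r).2)) ∈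
      signedClass J (-fun i : ↥(Finset.univ : Finset (Fin N)) => j i) := by
    have hocc (i) (x : Bool) : occurrences (fun r => ((s r).1, !(s r).2)) (i, x) =
        occurrences s (i, !x) := by
      unfold occurrences
      congr 1
      ext r
      cases x <;> simp [Prod.ext_iff]
    rw [mem_signedClass]
    intro i
    have := mem_signedClass.mp hs i
    rw [hocc, hocc]
    simpa using this.symm
  have h1 := phaseFunctional_cumulantPoly (fun i : ↥(Finset.univ : Finset (Fin N)) => k i) Pw P
    (by omega : J ≠ 0) (j := fun i : ↥(Finset.univ : Finset (Fin N)) => j i)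
    (by rw [hJ]; exact Finset.sum_coe_sort Finset.univ fun i => (j i).natAbs)
    (fun c hc => by
      obtain ⟨t, ht, -⟩ := exists_multiple_of_relation hrel _ c hc
      exact ⟨t, funext ht⟩)
    hs hs' hflip (by
      rw [hk]
      exact F.modePolyspectrum_comp_perm hP (fun i : ↥(Finset.univ : Finset (Fin N)) => m i) hJ3)
    (fun i => θ i)
  rw [h1, modePolyspectrum, hsl,
    Finset.prod_coe_sort Finset.univ fun i =>
      Real.Gamma (1 + ((j i).natAbs : ℝ) / 2) / ((j i).natAbs.factorial : ℝ),
    Finset.sum_coe_sort Finset.univ fun i => (j i : ℝ) * θ i]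

lemma BoxField.coeff_reducedPhase_leading (hP : F.HasPolyspectra Pw P) (hN : 2 ≤ N)
    (hparity : ∀ l : List (Fin d → ℝ), l.sum = 0 → P (l.map fun q => -q) = P l)
    (hm : ∀ i, F.wave (m i) = k i) (hU : IsUpperHalf U) (hkU : ∀ i, k i ∈ U)
    (hk : Function.Injective k) (hj : ∀ i, j i ≠ 0)
    (hrel : ∀ c : Fin N → ℤ, ∑ i, c i • k i = 0 ↔ ∃ t : ℤ, c = t • j)
    (hPw : ∀ i, 0 < Pw (k i)) {J : ℕ} (hJ : J = ∑ i, (j i).natAbs) (θ : Fin N → ℝ) :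
    PowerSeries.coeff (J - 2) (F.reducedPhase m θ) =
      ((2 * (∏ i, Real.Gamma (1 + ((j i).natAbs : ℝ) / 2) / ((j i).natAbs.factorial : ℝ)) *
        Real.cos (∑ i, (j i : ℝ) * θ i) : ℝ) : ℂ) *
        normPolyspectrum Pw P (signedCopies j k) := by
  have hJ3 : 3 ≤ J := hJ ▸ three_le_sum_natAbs hN hU hkU hk hj hrel
  have hJ2 : J - 2 + 2 = J := by omega
  rw [F.reducedPhase_eq hP hN hm hU hkU hk hj hrel hPw, if_neg (by omega), sub_zero,
    phaseFunctional_charPoly_leading hrel (by omega) (by omega), hJ2,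
    F.phaseFunctional_cumulantPoly_eq hP hparity hm hj hrel hJ3 hJ]
  have h1 : (-Complex.I) ^ J * Complex.I ^ J = 1 := by
    rw [← mul_pow, neg_mul, Complex.I_mul_I, neg_neg, one_pow]
  have h2 : (J.factorial : ℂ) ≠ 0 := by exact_mod_cast J.factorial_ne_zero
  field_simp
  rw [h1, one_mul]

end ReducedPhase

end

theorem mainTheorem10 {d N : ℕ} (hN : 2 ≤ N)
    -- the wavevectors: distinct elements of an upper half space
    (U : Set (Fin d → ℝ)) (hU : IsUpperHalf U)
    (k : Fin N → Fin d → ℝ) (hkU : ∀ i, k i ∈ U) (hk : Function.Injective k)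
    -- the integer linear relations among them are exactly the multiples of `j`
    (j : Fin N → ℤ) (hj : ∀ i, j i ≠ 0)
    (hrel : ∀ c : Fin N → ℤ, ∑ i, c i • k i = 0 ↔ ∃ t : ℤ, c = t • j)
    -- fields in boxes of various volumes, with common power spectrum and polyspectra
    {β : Type*} (F : β → BoxField d)
    (Pw : (Fin d → ℝ) → ℝ) (P : List (Fin d → ℝ) → ℂ)
    (hP : ∀ b, (F b).HasPolyspectra Pw P)
    (hparity : ∀ l : List (Fin d → ℝ), l.sum = 0 → P (l.map fun q => -q) = P l)
    (hPw : ∀ i, 0 < Pw (k i))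
    -- the labels of the wavevectors in each box
    (m : β → Fin N → Fin d → ℤ) (hm : ∀ b i, (F b).wave (m b i) = k i)
    (J : ℕ) (hJ : J = ∑ i, (j i).natAbs) :
    (∀ b θ, ∀ q < J - 2, PowerSeries.coeff q ((F b).reducedPhase (m b) θ) = 0) ∧
    (∀ b θ, PowerSeries.coeff (J - 2) ((F b).reducedPhase (m b) θ) =
      ((2 * (∏ i, Real.Gamma (1 + ((j i).natAbs : ℝ) / 2) / ((j i).natAbs.factorial : ℝ)) *
        Real.cos (∑ i, (j i : ℝ) * θ i) : ℝ) : ℂ) *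
        normPolyspectrum Pw P (signedCopies j k)) ∧
    (∀ M, J - 2 ≤ M → ∃ B : ℝ, ∀ b, 1 ≤ (F b).vol → ∀ θ,
      ‖(∑ q ∈ Finset.range (M + 1), PowerSeries.coeff q ((F b).reducedPhase (m b) θ) *
            (((F b).vol ^ (-(q : ℝ) / 2) : ℝ) : ℂ)) -
          ((2 * (F b).vol ^ ((2 - (J : ℝ)) / 2) *
            (∏ i, Real.Gamma (1 + ((j i).natAbs : ℝ) / 2) / ((j i).natAbs.factorial : ℝ)) *
            Real.cos (∑ i, (j i : ℝ) * θ i) : ℝ) : ℂ) *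
            normPolyspectrum Pw P (signedCopies j k)‖
        ≤ B * (F b).vol ^ ((1 - (J : ℝ)) / 2)) := by
  have hJ3 : 3 ≤ J := hJ ▸ three_le_sum_natAbs hN hU hkU hk hj hrel
  have hzero : ∀ b θ, ∀ q < J - 2, PowerSeries.coeff q ((F b).reducedPhase (m b) θ) = 0 := by
    intro b θ q hq
    rw [(F b).reducedPhase_eq (hP b) hN (hm b) hU hkU hk hj hrel hPw,
      phaseFunctional_charPoly_of_lt hrel (by omega), sub_self]
  have hlead := fun b => (F b).coeff_reducedPhase_leading (hP b) hN hparity (hm b) hU hkU hk hj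
    hrel hPw hJ
  refine ⟨hzero, hlead, fun M hM => ?_⟩
  -- The polynomial `charPoly` is built from `k`, `Pw` and `P` alone, so a single bound serves all
  -- boxes and all phases.
  have hbound (q : ℕ) : ∃ B : ℝ, ∀ b θ,
      ‖PowerSeries.coeff q ((F b).reducedPhase (m b) θ)‖ ≤ B := by
    obtain ⟨B, hB⟩ := exists_norm_phaseFunctional_le (charPoly_mem (q := q) (Pw := Pw) (P := P)
      (k := fun i : ↥(Finset.univ : Finset (Fin N)) => k i) (polyAlg _)
      fun l _ _ => cumulantPoly_mem_polyAlg _ _ _ _)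
    refine ⟨B + ‖if q = 0 then (1 : ℂ) else 0‖, fun b θ => ?_⟩
    rw [(F b).reducedPhase_eq (hP b) hN (hm b) hU hkU hk hj hrel hPw]
    exact (norm_sub_le _ _).trans (add_le_add_left (hB _) _)
  choose B hB using hbound
  refine ⟨∑ q ∈ Finset.range (M + 1), B q, fun b hb θ => ?_⟩
  have h := norm_truncated_sub_le (c := fun q => PowerSeries.coeff q ((F b).reducedPhase (m b) θ))
    (fun q => hB q b θ) (show 2 ≤ J by omega) hM (hzero b θ) hb
  simp only [hlead b θ] at h
  refine le_trans (le_of_eq ?_) h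
  congr 2
  push_cast
  ring
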